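/- Let $r\ge 1$, let $X_1,\dots,X_r$ be locally compact Hadamard spaces (complete geodesic metric spaces all of whose geodesic triangles satisfy the CAT(0)-inequality), and let $X=X_1\times\cdots\times X_r$ carry the $\ell^2$ product metric. Let $\partial X$ and $\partial X_i$ denote the geometric boundaries (asymptoty classes of geodesic rays) with the cone topology, and let the Furstenberg boundary be $\partial^F X:=\partial X_1\times\cdots\times\partial X_r$ with the product topology. Every geodesic ray of $X$ which does not project to a point in any factor has the form $t\mapsto(\sigma_1(\theta_1t),\dots,\sigma_r(\theta_rt))$ with geodesic rays $\sigma_i$ in $X_i$ and all $\theta_i>0$; the set of classes of such rays is the regular boundary $\partial X^{reg}\subset\partial X$, and $\pi^F:\partial X^{reg}\to\partial^F X$ sends the class of this ray to $(\sigma_1(\infty),\dots,\sigma_r(\infty))$. An isometry of a Hadamard space is rank one if it translates by some $l>0$ a geodesic line that does not bound a flat half-plane; isometries $g,h$ are independent if for every point $x$ the map $\mathbb Z\times\mathbb Z\to[0,\infty)$, $(m,n)\mapsto d(g^mx,h^nx)$, is proper. Let $\Gamma<\mathrm{Is}(X_1)\times\cdots\times\mathrm{Is}(X_r)$ act properly discontinuously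 on $X$ and contain two elements $g=(g_1,\dots,g_r)$ and $h=(h_1,\dots,h_r)$ such that for every $i$ the isometries $g_i$ and $h_i$ of $X_i$ are rank one and independent. Let $L_\Gamma:=\overline{\Gamma\cdot x}\cap\partial X$, where $x\in X$ is arbitrary and the closure is taken in $X\cup\partial X$ with the cone topology, and let $F_\Gamma:=\pi^F(L_\Gamma\cap\partial X^{reg})$ be the Furstenberg limit set of $\Gamma$. Then $F_\Gamma\subset\partial^F X$ is $\Gamma$-invariant, and the following hold. 1. For all $\zeta\in\partial^F X$ and every open subset $U\subset\partial^F X$ with $U\cap F_\Gamma\neq\emptyset$ there exists $\gamma\in\Gamma$ such that $\gamma\zeta\in U$. 2. For all $\zeta,\eta\in\partial^F X$ there exists $\xi\in F_\Gamma$ such that for every neighborhood $U$ of $\xi$ there exists $\gamma\in\Gamma$ with $\{\gamma\zeta,\gamma\eta\}\subset U$. 3. For all $\zeta\in\partial^F X$ there exist a neighborhood $V$ of $\zeta$ and a point $\xi\in F_\Gamma$ such that for every neighborhood $U$ of $\xi$ there exists $\gamma\in\Gamma$ with $\gamma V\subset U$. -/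

import Mathlib

open Set Filter Topology
open scoped NNReal

universe u

namespace HadamardProducts

section Spaces

variable {X : Type u} [MetricSpace X]

/-- `σ`, restricted to `[0, l]`, is a geodesic path joining `x` to `y`. -/
def IsGeodesicPath (σ : ℝ → X) (l : ℝ) (x y : X) : Prop :=
  0 ≤ l ∧ σ 0 = x ∧ σ l = y ∧
    ∀ s ∈ Icc (0 : ℝ) l, ∀ t ∈ Icc (0 : ℝ) l, dist (σ s) (σ t) = |s - t|

/-- All geodesic triangles of `X` are at least as thin as their comparison triangles in the
Euclidean plane. Two sides of a triangle share a vertex, called `x` here; `x' y' z'` is a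
comparison triangle of `x y z`, and `p'`, `q'` are the comparison points of the points `σ s` of the
side from `x` to `y` and `τ t` of the side from `x` to `z`. -/
def SatisfiesCAT0 (X : Type u) [MetricSpace X] : Prop :=
  ∀ (x y z : X) (σ τ : ℝ → X) (a b : ℝ),
    IsGeodesicPath σ a x y → IsGeodesicPath τ b x z →
    ∀ x' y' z' : EuclideanSpace ℝ (Fin 2),
      dist x' y' = dist x y → dist x' z' = dist x z → dist y' z' = dist y z →
    ∀ s ∈ Icc (0 : ℝ) a, ∀ t ∈ Icc (0 : ℝ) b, ∀ p' q' : EuclideanSpace ℝ (Fin 2),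
      dist x' p' = s → dist p' y' = a - s → dist x' q' = t → dist q' z' = b - t →
      dist (σ s) (τ t) ≤ dist p' q'

/-- A Hadamard space: a complete geodesic metric space all of whose triangles satisfy the
CAT(0)-inequality. -/
structure IsHadamard (X : Type u) [MetricSpace X] : Prop where
  complete : CompleteSpace X
  geodesic : ∀ x y : X, ∃ (σ : ℝ → X) (l : ℝ), IsGeodesicPath σ l x y
  cat0 : SatisfiesCAT0 X

/-- A geodesic ray, parametrized by arc length on `[0, ∞)`. -/
structure Ray (X : Type u) [MetricSpace X] where
  toFun : ℝ≥0 → X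
  isometry : Isometry toFun

instance : CoeFun (Ray X) (fun _ => ℝ≥0 → X) := ⟨Ray.toFun⟩

/-- The image of a geodesic ray under an isometry. -/
def Ray.map (f : X ≃ᵢ X) (ρ : Ray X) : Ray X := ⟨f ∘ ρ, f.isometry.comp ρ.isometry⟩

/-- Two rays are asymptotic if they stay at bounded distance. -/
def Asymptotic (ρ ρ' : Ray X) : Prop := ∃ C : ℝ, ∀ t, dist (ρ t) (ρ' t) ≤ C

instance raySetoid (X : Type u) [MetricSpace X] : Setoid (Ray X) where
  r := Asymptotic
  iseqv :=
    { refl := fun ρ => ⟨0, fun t => by simp⟩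
      symm := fun ⟨C, h⟩ => ⟨C, fun t => by rw [dist_comm]; exact h t⟩
      trans := fun ⟨C, h⟩ ⟨D, k⟩ =>
        ⟨C + D, fun t => (dist_triangle _ _ _).trans (add_le_add (h t) (k t))⟩ }

/-- The geometric boundary: asymptoty classes of geodesic rays. -/
def Boundary (X : Type u) [MetricSpace X] : Type u := Quotient (raySetoid X)

/-- The boundary point represented by a ray. -/
def Ray.endpoint (ρ : Ray X) : Boundary X := Quotient.mk (raySetoid X) ρ

/-- The action of an isometry on the geometric boundary. -/
def Boundary.map (f : X ≃ᵢ X) : Boundary X → Boundary X :=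
  Quotient.map (Ray.map f) (by
    rintro ρ ρ' ⟨C, h⟩
    refine ⟨C, fun t => ?_⟩
    exact (f.isometry.dist_eq _ _).trans_le (h t))

/-- The set `X ∪ ∂X`. -/
inductive Compactification (X : Type u) [MetricSpace X] : Type u
  | pt : X → Compactification X
  | bd : Boundary X → Compactification X

/-- The set of all `z ∈ X ∪ ∂X` outside of the closed ball of radius `R` about `x` such that
the geodesic path (or ray) from `x` to `z` and the ray from `x` to `ξ` are at distance less than
`ε` from each other at time `R`. -/
def coneNhd (x : X) (ξ : Boundary X) (R : ℝ≥0) (ε : ℝ) : Set (Compactification X) :=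
  {z | ∃ ρ : Ray X, ρ 0 = x ∧ ρ.endpoint = ξ ∧
    match z with
    | .pt y => (R : ℝ) < dist x y ∧
        ∃ (σ : ℝ → X) (l : ℝ), IsGeodesicPath σ l x y ∧ dist (σ R) (ρ R) < ε
    | .bd η => ∃ ρ' : Ray X, ρ' 0 = x ∧ ρ'.endpoint = η ∧ dist (ρ' R) (ρ R) < ε}

/-- The cone topology on `X ∪ ∂X`, generated by the open subsets of `X` and the sets
`coneNhd x ξ R ε`. -/
instance : TopologicalSpace (Compactification X) :=
  TopologicalSpace.generateFrom
    ({W | ∃ V : Set X, IsOpen V ∧ W = Compactification.pt '' V} ∪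
      {W | ∃ (x : X) (ξ : Boundary X) (R : ℝ≥0) (ε : ℝ), 0 < ε ∧ W = coneNhd x ξ R ε})

/-- The cone topology on the geometric boundary, as a subspace of `X ∪ ∂X`. -/
instance : TopologicalSpace (Boundary X) :=
  TopologicalSpace.induced Compactification.bd inferInstance

/-- The geodesic `σ : ℝ → X` bounds a flat half-plane. (The image of an isometric map defined on
the half-plane `[0, ∞) × ℝ` is automatically closed and convex in a Hadamard space.) -/
def BoundsFlatHalfPlane (σ : ℝ → X) : Prop :=
  ∃ ι : WithLp 2 (ℝ≥0 × ℝ) → X, Isometry ι ∧ ∀ t : ℝ, ι (WithLp.toLp 2 (0, t)) = σ t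

/-- A rank one isometry: an isometry which translates by some `l > 0` a geodesic line `σ`
that does not bound a flat half-plane. -/
def IsRankOne (h : X ≃ᵢ X) : Prop :=
  ∃ (l : ℝ) (σ : ℝ → X), 0 < l ∧ Isometry σ ∧ (∀ t, h (σ t) = σ (t + l)) ∧
    ¬ BoundsFlatHalfPlane σ

/-- Independence of two (axial) isometries: all maps `(m, n) ↦ d(g^m x, h^n x)` are proper. -/
def Independent (g h : X ≃ᵢ X) : Prop :=
  ∀ x : X, IsProperMap (fun p : ℤ × ℤ => dist ((g ^ p.1) x) ((h ^ p.2) x))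

end Spaces

section Products

variable {r : ℕ} {X : Fin r → Type u} [∀ i, MetricSpace (X i)]

/-- The Furstenberg boundary `∂X₁ × ⋯ × ∂X_r`, with the product topology. -/
abbrev FurstenbergBoundary (X : Fin r → Type u) [∀ i, MetricSpace (X i)] : Type u :=
  ∀ i, Boundary (X i)

/-- The action of `Is(X₁) × ⋯ × Is(X_r)` on the product `X` with the `ℓ²`-metric. -/
def act (γ : ∀ i, X i ≃ᵢ X i) (x : PiLp 2 X) : PiLp 2 X := WithLp.toLp 2 fun i => γ i (x i)

/-- The action of `Is(X₁) × ⋯ × Is(X_r)` on the Furstenberg boundary. -/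
def actF (γ : ∀ i, X i ≃ᵢ X i) (ξ : FurstenbergBoundary X) : FurstenbergBoundary X :=
  fun i => Boundary.map (γ i) (ξ i)

/-- `Γ` acts properly discontinuously on the product `X`. -/
def ActsProperlyDiscontinuously (Γ : Subgroup (∀ i, X i ≃ᵢ X i)) : Prop :=
  ∀ K : Set (PiLp 2 X), IsCompact K → {γ | γ ∈ Γ ∧ (act γ '' K ∩ K).Nonempty}.Finite

/-- An element of `Is(X₁) × ⋯ × Is(X_r)` is regular axial if all its components are rank one. -/
def IsRegularAxial (h : ∀ i, X i ≃ᵢ X i) : Prop := ∀ i, IsRankOne (h i)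

/-- The slope of a geodesic ray in the product: the direction of `ρ 1` with respect to `ρ 0`. -/
noncomputable def slope (ρ : Ray (PiLp 2 X)) : Fin r → ℝ≥0 := fun i => nndist (ρ 0 i) (ρ 1 i)

/-- The regular geometric boundary: classes of rays whose slope has no coordinate zero. -/
def regularBoundary (X : Fin r → Type u) [∀ i, MetricSpace (X i)] : Set (Boundary (PiLp 2 X)) :=
  {ζ | ∃ ρ : Ray (PiLp 2 X), ρ.endpoint = ζ ∧ ∀ i, 0 < slope ρ i}

/-- The graph of the projection of the regular boundary to the Furstenberg boundary: `ζ` is the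
class of a ray `ρ` of slope `θ` which has the form `ρ(t) = (ρ₁(θ₁ t), …, ρ_r(θ_r t))`
with geodesic rays `ρ_i` in the classes `ξ_i`. -/
def ProjectsTo (ζ : Boundary (PiLp 2 X)) (ξ : FurstenbergBoundary X) : Prop :=
  ∃ ρ : Ray (PiLp 2 X), ρ.endpoint = ζ ∧ ∃ ρ' : ∀ i, Ray (X i),
    (∀ i, (ρ' i).endpoint = ξ i) ∧ ∀ t i, ρ t i = ρ' i (slope ρ i * t)

/-- The geometric limit set of `Γ`: the boundary points in the closure of the orbit of `x`. -/
def limitSet (Γ : Subgroup (∀ i, X i ≃ᵢ X i)) (x : PiLp 2 X) : Set (Boundary (PiLp 2 X)) :=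
  {ζ | Compactification.bd ζ ∈ closure {z | ∃ γ ∈ Γ, z = Compactification.pt (act γ x)}}

/-- The Furstenberg limit set of `Γ`: the projection of the set of all regular limit points. -/
def furstenbergLimitSet (Γ : Subgroup (∀ i, X i ≃ᵢ X i)) (x : PiLp 2 X) :
    Set (FurstenbergBoundary X) :=
  {ξ | ∃ ζ ∈ limitSet Γ x ∩ regularBoundary X, ProjectsTo ζ ξ}

end Products

end HadamardProducts

namespace HadamardProducts

/-! The engine is north-south dynamics. In a proper Hadamard space, the powers of a rank one
isometry contract a neighbourhood of any boundary point other than its repelling fixed point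
uniformly towards its attracting fixed point (`IsRankOneAxis.exists_nhds_pow_subset`).

Two facts about a line `σ` that bounds no flat half-plane give this. First, let `m` be the slope at
`-∞`, along the axis, of the Busemann function of a boundary point `η`. Any limit of the rays from
`σ 0` to the translates of `η` spans with `σ` a flat sector whose angle has cosine `-m`. If `|m| <
1`, the sector develops to a flat half-plane; if `m = 1`, then `η` is the repelling point; if `m =
-1`, the translates accumulate at the attracting point (`IsRankOneAxis.exists_pow_near`). Second,
geodesics joining points near the two ends of `σ` pass within bounded distance of `σ 0`; otherwise
the points of such geodesics nearest to `σ 0` produce a ray orthogonal to `σ`, hence again a flat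
half-plane (`exists_infDist_segSet_le`).

In the product, independence makes the four fixed points of `g i` and `h i` distinct, and those of
`g i` are not periodic under `h i`. So for all but finitely many `n` the conjugate of `g` by `h ^ n`
is regular axial with fixed points avoiding given points in every factor at once
(`exists_regularAxial_avoiding`). Its attracting point lies in the Furstenberg limit set, and its
powers prove statements 2 and 3.

For statement 1, take `γ n` in `Γ` with `γ n x` tending to the given limit point in every factor,
and let `η` be a limit of the points `(γ n)⁻¹ x`. For a regular axial `k` with attracting point off
`η` and repelling point off `ζ`, some `γ n` moves the attracting point into `U`, and then `γ n * k ^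
j` moves `ζ` into `U` for large `j` (`exists_actF_mem`).

All metric estimates are drawn from the Bruhat-Tits inequality, which passes to `ℓ²` products by
summing over the factors. -/

/-- A space in which every pair of points has, for every `s ∈ [0, 1]`, a point dividing it in the
ratio `s : 1 - s` which satisfies the Bruhat-Tits inequality. -/
class IsCNSpace (X : Type u) [MetricSpace X] : Prop where
  exists_cn : ∀ x y : X, ∀ s ∈ Icc (0 : ℝ) 1, ∃ m : X, ∀ p : X,
    dist p m ^ 2 ≤ (1 - s) * dist p x ^ 2 + s * dist p y ^ 2 - s * (1 - s) * dist x y ^ 2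

/-! ### From the CAT(0)-inequality to the Bruhat-Tits inequality. -/

section Comparison

theorem exists_comparison_triangle {a b c : ℝ} (ha : 0 ≤ a) (hb : 0 ≤ b)
    (h1 : c ≤ a + b) (h2 : a ≤ b + c) (h3 : b ≤ a + c) :
    ∃ x y z : EuclideanSpace ℝ (Fin 2), dist x y = a ∧ dist x z = b ∧ dist y z = c := by
  have hc : 0 ≤ c := by linarith
  rcases ha.eq_or_lt with rfl | ha'
  · have hbc : b = c := by linarith
    refine ⟨!₂[0, 0], !₂[0, 0], !₂[b, 0], ?_, ?_, ?_⟩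
    · simp
    · simp [EuclideanSpace.dist_eq, Fin.sum_univ_two, Real.sqrt_sq hb]
    · simp [EuclideanSpace.dist_eq, Fin.sum_univ_two, hbc, Real.sqrt_sq hc]
  -- The law of cosines dictates the first coordinate of the third vertex; the triangle inequalities
  -- give `|w| ≤ b`, so a second coordinate exists.
  · set w : ℝ := (a ^ 2 + b ^ 2 - c ^ 2) / (2 * a) with hw
    have hwa : 2 * a * w = a ^ 2 + b ^ 2 - c ^ 2 := by rw [hw]; field_simp
    have hwb : w ^ 2 ≤ b ^ 2 := by
      have e1 : w ≤ b := by
        rw [hw, div_le_iff₀ (by linarith)]; nlinarith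
      have e2 : -b ≤ w := by
        rw [hw, le_div_iff₀ (by linarith)]; nlinarith
      exact sq_le_sq' e2 e1
    have hv := Real.sq_sqrt (sub_nonneg.2 hwb)
    refine ⟨!₂[0, 0], !₂[a, 0], !₂[w, √(b ^ 2 - w ^ 2)], ?_, ?_, ?_⟩
    · simp [EuclideanSpace.dist_eq, Fin.sum_univ_two, Real.sqrt_sq ha]
    · rw [EuclideanSpace.dist_eq, Real.sqrt_eq_iff_mul_self_eq (by positivity) hb]
      simp only [Fin.sum_univ_two, Real.dist_eq, sq_abs]
      simp
      linarith
    · rw [EuclideanSpace.dist_eq, Real.sqrt_eq_iff_mul_self_eq (by positivity) hc]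
      simp only [Fin.sum_univ_two, Real.dist_eq, sq_abs]
      simp
      nlinarith

/-- The CAT(0)-inequality is needed only between a point of one side and the opposite vertex `p`;
the Euclidean distance between their comparison points is given by Stewart's identity. -/
theorem IsHadamard.isCNSpace {X : Type u} [MetricSpace X] (hX : IsHadamard X) : IsCNSpace X := by
  refine ⟨fun x y s hs => ?_⟩
  obtain ⟨σ, l, hσ⟩ := hX.geodesic x y
  have hl : dist x y = l := by
    have := hσ.2.2.2 0 ⟨le_rfl, hσ.1⟩ l ⟨hσ.1, le_rfl⟩
    rwa [hσ.2.1, hσ.2.2.1, zero_sub, abs_neg, abs_of_nonneg hσ.1] at this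
  refine ⟨σ (s * l), fun p => ?_⟩
  obtain ⟨τ, b, hτ⟩ := hX.geodesic x p
  have hb : dist x p = b := by
    have := hτ.2.2.2 0 ⟨le_rfl, hτ.1⟩ b ⟨hτ.1, le_rfl⟩
    rwa [hτ.2.1, hτ.2.2.1, zero_sub, abs_neg, abs_of_nonneg hτ.1] at this
  obtain ⟨x', y', p', h1, h2, h3⟩ := exists_comparison_triangle (a := dist x y) (b := dist x p)
    (c := dist y p) dist_nonneg dist_nonneg (by rw [dist_comm x y]; exact dist_triangle _ _ _)
    (by rw [dist_comm y p]; exact dist_triangle _ _ _) (dist_triangle _ _ _)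
  have hsl : s * l ∈ Icc (0 : ℝ) l :=
    ⟨mul_nonneg hs.1 hσ.1, mul_le_of_le_one_left hσ.1 hs.2⟩
  set m' := AffineMap.lineMap (k := ℝ) x' y' s with hm'
  have key := hX.cat0 x y p σ τ l b hσ hτ x' y' p' h1 h2 h3 (s * l) hsl b ⟨hτ.1, le_rfl⟩ m' p'
    (by rw [hm', dist_left_lineMap, h1, hl, Real.norm_eq_abs, abs_of_nonneg hs.1])
    (by rw [hm', dist_lineMap_right, h1, hl, Real.norm_eq_abs, abs_of_nonneg (by linarith [hs.2])]
        ring)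
    (by rw [h2, hb]) (by simp)
  rw [hτ.2.2.1] at key
  have e : dist m' p' ^ 2 =
      (1 - s) * dist p x ^ 2 + s * dist p y ^ 2 - s * (1 - s) * dist x y ^ 2 := by
    rw [dist_comm p x, dist_comm p y, ← h1, ← h2, ← h3, hm']
    simp only [EuclideanSpace.dist_eq, Fin.sum_univ_two, Real.dist_eq, sq_abs]
    rw [Real.sq_sqrt (by positivity), Real.sq_sqrt (by positivity), Real.sq_sqrt (by positivity),
      Real.sq_sqrt (by positivity)]
    simp [AffineMap.lineMap_apply]
    ring
  rw [← e, dist_comm p]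
  exact pow_le_pow_left₀ dist_nonneg key 2

end Comparison

/-! ### Unique geodesics, their convexity properties, and properness. -/

section Geodesics

variable {X : Type u} [MetricSpace X] [IsCNSpace X]

open Classical in
/-- The point dividing the geodesic from `x` to `y` in the ratio `s : 1 - s`. -/
noncomputable def geo (x y : X) (s : ℝ) : X :=
  if h : s ∈ Icc (0 : ℝ) 1 then Classical.choose (IsCNSpace.exists_cn x y s h) else x

theorem dist_geo_sq_le (p x y : X) {s : ℝ} (hs : s ∈ Icc (0 : ℝ) 1) :
    dist p (geo x y s) ^ 2 ≤
      (1 - s) * dist p x ^ 2 + s * dist p y ^ 2 - s * (1 - s) * dist x y ^ 2 := by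
  rw [geo, dif_pos hs]
  exact Classical.choose_spec (IsCNSpace.exists_cn x y s hs) p

/-- The Bruhat-Tits inequality at the two endpoints gives upper bounds whose sum is `dist x y`, so
the triangle inequality makes both sharp. -/
theorem dist_left_geo_and (x y : X) {s : ℝ} (hs : s ∈ Icc (0 : ℝ) 1) :
    dist x (geo x y s) = s * dist x y ∧ dist (geo x y s) y = (1 - s) * dist x y := by
  have h1 := dist_geo_sq_le x x y hs
  have h2 := dist_geo_sq_le y x y hs
  rw [dist_self, dist_comm y] at h2
  rw [dist_self] at h1
  have d0 : 0 ≤ dist x y := dist_nonneg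
  have h1' : dist x (geo x y s) ≤ s * dist x y :=
    abs_le_of_sq_le_sq' (by nlinarith) (mul_nonneg hs.1 d0) |>.2
  have h2' : dist (geo x y s) y ≤ (1 - s) * dist x y := by
    rw [dist_comm]
    refine abs_le_of_sq_le_sq' ?_ (mul_nonneg (by linarith [hs.2]) d0) |>.2
    rw [dist_comm y x] at h2
    rw [dist_comm y (geo x y s)]
    nlinarith
  have h3 := dist_triangle x (geo x y s) y
  constructor <;> linarith

theorem dist_left_geo (x y : X) {s : ℝ} (hs : s ∈ Icc (0 : ℝ) 1) :
    dist x (geo x y s) = s * dist x y := (dist_left_geo_and x y hs).1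

theorem dist_geo_right (x y : X) {s : ℝ} (hs : s ∈ Icc (0 : ℝ) 1) :
    dist (geo x y s) y = (1 - s) * dist x y := (dist_left_geo_and x y hs).2

/-- Uniqueness of geodesics: at `m`, the right-hand side of the Bruhat-Tits inequality is at most
zero. -/
theorem eq_geo {x y m : X} {s : ℝ} (hs : s ∈ Icc (0 : ℝ) 1)
    (h1 : dist x m ≤ s * dist x y) (h2 : dist m y ≤ (1 - s) * dist x y) : m = geo x y s := by
  have h := dist_geo_sq_le m x y hs
  rw [dist_comm m x] at h
  have d0 : 0 ≤ dist x m := dist_nonneg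
  have d1 : 0 ≤ dist m y := dist_nonneg
  have e1 : dist x m ^ 2 ≤ (s * dist x y) ^ 2 := pow_le_pow_left₀ d0 h1 2
  have e2 : dist m y ^ 2 ≤ ((1 - s) * dist x y) ^ 2 := pow_le_pow_left₀ d1 h2 2
  have : dist m (geo x y s) ^ 2 ≤ 0 := by
    have s1 := mul_le_mul_of_nonneg_left e1 (sub_nonneg.2 hs.2)
    have s2 := mul_le_mul_of_nonneg_left e2 hs.1
    nlinarith
  exact dist_eq_zero.1 (pow_eq_zero_iff two_ne_zero |>.1 (le_antisymm this (sq_nonneg _)))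

theorem one_sub_mem_unit {s : ℝ} (hs : s ∈ Icc (0 : ℝ) 1) : 1 - s ∈ Icc (0 : ℝ) 1 :=
  ⟨by linarith [hs.2], by linarith [hs.1]⟩

theorem geo_comm (x y : X) {s : ℝ} (hs : s ∈ Icc (0 : ℝ) 1) : geo x y s = geo y x (1 - s) := by
  refine eq_geo (one_sub_mem_unit hs) ?_ ?_
  · rw [dist_comm, dist_geo_right x y hs, dist_comm x y]
  · rw [dist_comm, dist_left_geo x y hs, dist_comm x y]; simp

@[simp] theorem geo_zero (x y : X) : geo x y 0 = x :=
  (eq_geo (by simp) (by simp) (by simp)).symm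

@[simp] theorem geo_one (x y : X) : geo x y 1 = y :=
  (eq_geo (by simp) (by simp) (by simp)).symm

/-- Two uses of the Bruhat-Tits inequality, at `geo x y s` and at `z`; the terms in `dist x y` and
`dist x z` cancel. -/
theorem dist_geo_geo_left_le (x y z : X) {s : ℝ} (hs : s ∈ Icc (0 : ℝ) 1) :
    dist (geo x y s) (geo x z s) ≤ s * dist y z := by
  have h1 := dist_geo_sq_le (geo x y s) x z hs
  have h2 := dist_geo_sq_le z x y hs
  rw [dist_comm z (geo x y s), dist_comm z x, dist_comm z y] at h2
  rw [dist_comm _ x, dist_left_geo x y hs] at h1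
  have := mul_le_mul_of_nonneg_left h2 hs.1
  refine abs_le_of_sq_le_sq' ?_ (mul_nonneg hs.1 dist_nonneg) |>.2
  nlinarith

theorem dist_geo_geo_right_le (x y z : X) {s : ℝ} (hs : s ∈ Icc (0 : ℝ) 1) :
    dist (geo x z s) (geo y z s) ≤ (1 - s) * dist x y := by
  rw [geo_comm x z hs, geo_comm y z hs]
  exact dist_geo_geo_left_le z x y (one_sub_mem_unit hs)

theorem dist_geo_geo_le (x y x' y' : X) {s : ℝ} (hs : s ∈ Icc (0 : ℝ) 1) :
    dist (geo x y s) (geo x' y' s) ≤ (1 - s) * dist x x' + s * dist y y' :=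
  (dist_triangle _ (geo x' y s) _).trans
    (add_le_add (dist_geo_geo_right_le x x' y hs) (dist_geo_geo_left_le x' y y' hs))

theorem geo_geo (x y : X) {s t : ℝ} (hs : s ∈ Icc (0 : ℝ) 1) (ht : t ∈ Icc (0 : ℝ) 1) :
    geo x (geo x y s) t = geo x y (s * t) := by
  have hst : s * t ∈ Icc (0 : ℝ) 1 := ⟨mul_nonneg hs.1 ht.1, mul_le_one₀ hs.2 ht.1 ht.2⟩
  have e1 : dist x (geo x (geo x y s) t) = t * (s * dist x y) := by
    rw [dist_left_geo _ _ ht, dist_left_geo _ _ hs]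
  refine eq_geo hst (by rw [e1]; linarith) ?_
  have e2 := dist_geo_right x (geo x y s) ht
  rw [dist_left_geo _ _ hs] at e2
  have e3 := dist_geo_right x y hs
  have := dist_triangle (geo x (geo x y s) t) (geo x y s) y
  linarith

/-- The geodesic from `x` to `y`, parametrized by arc length. -/
noncomputable def seg (x y : X) (t : ℝ) : X := geo x y (t / dist x y)

theorem div_mem_unit {t d : ℝ} (ht : 0 ≤ t) (h : t ≤ d) : t / d ∈ Icc (0 : ℝ) 1 :=
  ⟨div_nonneg ht (ht.trans h), div_le_one_of_le₀ h (ht.trans h)⟩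

theorem div_mul_self_of_le {t d : ℝ} (ht : 0 ≤ t) (h : t ≤ d) : t / d * d = t := by
  rcases (ht.trans h).eq_or_lt with h0 | h0
  · rw [← h0, mul_zero]; linarith
  · field_simp

theorem dist_left_seg {x y : X} {t : ℝ} (ht : 0 ≤ t) (h : t ≤ dist x y) :
    dist x (seg x y t) = t := by
  rw [seg, dist_left_geo _ _ (div_mem_unit ht h), div_mul_self_of_le ht h]

theorem dist_seg_right {x y : X} {t : ℝ} (ht : 0 ≤ t) (h : t ≤ dist x y) :
    dist (seg x y t) y = dist x y - t := by
  rw [seg, dist_geo_right _ _ (div_mem_unit ht h), sub_mul, div_mul_self_of_le ht h, one_mul]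

@[simp] theorem seg_zero (x y : X) : seg x y 0 = x := by simp [seg]

@[simp] theorem seg_dist (x y : X) : seg x y (dist x y) = y := by
  rcases eq_or_ne x y with rfl | h
  · simp [seg]
  · rw [seg, div_self (dist_ne_zero.2 h), geo_one]

theorem eq_seg {x y m : X} (h : dist x m + dist m y ≤ dist x y) : m = seg x y (dist x m) := by
  have h0 : dist x m ≤ dist x y := by linarith [dist_nonneg (x := m) (y := y)]
  have e := div_mul_self_of_le (dist_nonneg (x := x) (y := m)) h0
  refine eq_geo (div_mem_unit dist_nonneg h0) ?_ ?_
  · rw [e]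
  · rw [sub_mul, e]; linarith

theorem seg_seg {x y : X} {s t : ℝ} (ht : 0 ≤ t) (hts : t ≤ s) (hs : s ≤ dist x y) :
    seg x (seg x y s) t = seg x y t := by
  have h1 := dist_left_seg (ht.trans hts) hs
  rw [seg, h1, seg, geo_geo _ _ (div_mem_unit (ht.trans hts) hs) (div_mem_unit ht hts), seg]
  congr 1
  rcases (ht.trans hts).eq_or_lt with h0 | h0
  · have : t = 0 := by linarith
    simp [this]
  · field_simp

theorem dist_seg_seg {x y : X} {s t : ℝ} (hs : s ∈ Icc 0 (dist x y)) (ht : t ∈ Icc 0 (dist x y)) :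
    dist (seg x y s) (seg x y t) = |s - t| := by
  wlog h : s ≤ t generalizing s t
  · rw [dist_comm, this ht hs (le_of_not_ge h), abs_sub_comm]
  · have h1 := dist_left_seg ht.1 ht.2
    rw [← seg_seg hs.1 h ht.2, dist_seg_right hs.1 (by rw [h1]; exact h), h1,
      abs_sub_comm, abs_of_nonneg (by linarith)]

theorem isGeodesicPath_seg (x y : X) : IsGeodesicPath (seg x y) (dist x y) x y :=
  ⟨dist_nonneg, seg_zero x y, seg_dist x y, fun _ hs _ ht => dist_seg_seg hs ht⟩

theorem IsGeodesicPath.length_eq {X : Type u} [MetricSpace X] {x y : X} {σ : ℝ → X} {l : ℝ} (h : IsGeodesicPath σ l x y) :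
    l = dist x y := by
  have := h.2.2.2 0 ⟨le_rfl, h.1⟩ l ⟨h.1, le_rfl⟩
  rw [h.2.1, h.2.2.1, zero_sub, abs_neg, abs_of_nonneg h.1] at this
  exact this.symm

theorem IsGeodesicPath.eq_seg {x y : X} {σ : ℝ → X} {l : ℝ} (h : IsGeodesicPath σ l x y) {t : ℝ}
    (ht : t ∈ Icc 0 l) : σ t = seg x y t := by
  have hl := h.length_eq
  have h1 := h.2.2.2 0 ⟨le_rfl, h.1⟩ t ht
  have h2 := h.2.2.2 t ht l ⟨h.1, le_rfl⟩
  rw [h.2.1, zero_sub, abs_neg, abs_of_nonneg ht.1] at h1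
  rw [h.2.2.1, abs_sub_comm, abs_of_nonneg (by linarith [ht.2])] at h2
  have := HadamardProducts.eq_seg (x := x) (y := y) (m := σ t) (by linarith)
  rwa [h1] at this

/-- Convexity of the squared distance along a geodesic, in the arc length parametrization. -/
theorem dist_seg_sq_sub_le (p x y : X) {s : ℝ} (hs : 0 ≤ s) (h : s ≤ dist x y) :
    dist p (seg x y s) ^ 2 - s ^ 2 ≤ (1 - s / dist x y) * dist p x ^ 2 +
      s / dist x y * (dist p y ^ 2 - dist x y ^ 2) := by
  have := dist_geo_sq_le p x y (div_mem_unit hs h)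
  have e := div_mul_self_of_le hs h
  rw [seg]
  have e2 : s / dist x y * (1 - s / dist x y) * dist x y ^ 2 =
      s / dist x y * dist x y ^ 2 - s ^ 2 := by
    rw [mul_sub, sub_mul, mul_one]
    congr 1
    rw [← sq, ← mul_pow, e]
  linarith

/-- The factor 2 pays for unequal lengths: one share of `dist a b` contracts the endpoints, the
other corrects the arc length parameter. -/
theorem dist_seg_seg_left_le {x a b : X} {t : ℝ} (ht : 0 ≤ t) (ha : t ≤ dist x a)
    (hb : t ≤ dist x b) :
    dist (seg x a t) (seg x b t) ≤ 2 * t * dist a b / dist x a := by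
  have hs := div_mem_unit ht ha
  set s := t / dist x a with hsdef
  have es : s * dist x a = t := div_mul_self_of_le ht ha
  have h1 : dist (seg x a t) (geo x b s) ≤ s * dist a b := by
    rw [seg, ← hsdef]; exact dist_geo_geo_left_le _ _ _ hs
  have h2 : geo x b s = seg x b (s * dist x b) := by
    rw [seg]
    rcases (dist_nonneg (x := x) (y := b)).eq_or_lt with h | h
    · rw [dist_eq_zero.1 h.symm]
      have hz : ∀ u ∈ Icc (0 : ℝ) 1, geo b b u = b := fun u hu =>
        (eq_geo hu (by simp) (by simp)).symm
      rw [hz s hs, hz _ (by simp)]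
    · rw [mul_div_assoc, div_self h.ne', mul_one]
  have h3 : dist (geo x b s) (seg x b t) ≤ s * dist a b := by
    rw [h2, dist_seg_seg ⟨mul_nonneg hs.1 dist_nonneg, mul_le_of_le_one_left dist_nonneg hs.2⟩
      ⟨ht, hb⟩, ← es, ← mul_sub, abs_mul, abs_of_nonneg hs.1]
    refine mul_le_mul_of_nonneg_left ?_ hs.1
    rw [abs_sub_comm, dist_comm x a, dist_comm x b]
    exact abs_dist_sub_le a b x
  calc dist (seg x a t) (seg x b t) ≤ s * dist a b + s * dist a b :=
        (dist_triangle _ _ _).trans (add_le_add h1 h3)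
    _ = _ := by rw [hsdef]; ring

/-- If `b` lies on the geodesic from `x` to `y`, then the geodesic from `x` to `y` is close to the
geodesic from `x` to any point near `b`. -/
theorem dist_seg_seg_le_of_near {x y a b : X} (hb : dist x b + dist b y ≤ dist x y) {C D t : ℝ}
    (hC : dist b a ≤ C) (hD : D ≤ dist x a) (ht : 0 ≤ t) (htD : t ≤ D - C) (h0 : 0 < D - C) :
    dist (seg x y t) (seg x a t) ≤ 2 * t * C / (D - C) := by
  have hC0 : 0 ≤ C := dist_nonneg.trans hC
  have hxb : D - C ≤ dist x b := by
    have := dist_triangle x b a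
    linarith
  have hby : dist x b ≤ dist x y := by linarith [dist_nonneg (x := b) (y := y)]
  have e : seg x y t = seg x b t := by
    conv_rhs => rw [eq_seg hb]
    rw [seg_seg ht (by linarith) hby]
  rw [e]
  refine (dist_seg_seg_left_le ht (by linarith) (by linarith)).trans ?_
  exact div_le_div₀ (by positivity) (mul_le_mul_of_nonneg_left hC (by positivity)) h0 hxb

theorem map_seg (f : X ≃ᵢ X) (x y : X) {t : ℝ} (h0 : 0 ≤ t) (h : t ≤ dist x y) :
    f (seg x y t) = seg (f x) (f y) t := by
  have h1 := dist_left_seg h0 h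
  have h2 := dist_seg_right h0 h
  have := eq_seg (x := f x) (y := f y) (m := f (seg x y t)) (by
    rw [f.isometry.dist_eq, f.isometry.dist_eq, f.isometry.dist_eq]; linarith)
  rwa [f.isometry.dist_eq, h1] at this

/-- The Hopf-Rinow theorem. -/
theorem properSpace_of_locallyCompact (X : Type u) [MetricSpace X] [IsCNSpace X]
    [CompleteSpace X] [LocallyCompactSpace X] : ProperSpace X := by
  refine ⟨fun o r => ?_⟩
  have grow : ∀ r, 0 ≤ r → IsCompact (Metric.closedBall o r) →
      ∃ δ > 0, IsCompact (Metric.closedBall o (r + δ)) := by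
    intro r hr hc
    obtain ⟨K, hK, hrK⟩ := exists_compact_superset hc
    obtain ⟨δ, hδ, hsub⟩ := hc.exists_cthickening_subset_open isOpen_interior hrK
    refine ⟨δ, hδ, hK.of_isClosed_subset Metric.isClosed_closedBall ?_⟩
    refine Subset.trans ?_ (hsub.trans interior_subset)
    intro y hy
    rw [Metric.mem_closedBall, dist_comm] at hy
    rcases le_total (dist o y) r with h | h
    · exact Metric.self_subset_cthickening _ (by rwa [Metric.mem_closedBall, dist_comm])
    · refine Metric.mem_cthickening_of_dist_le y (seg o y r) δ _ ?_ ?_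
      · rw [Metric.mem_closedBall, dist_comm, dist_left_seg hr h]
      · rw [dist_comm, dist_seg_right hr h]; linarith
  -- Every point of the closed ball of radius `r` is within `ε / 4` of a smaller closed ball, so
  -- total boundedness passes to the limit radius; completeness does the rest.
  have limit : ∀ r, 0 < r → (∀ s, 0 ≤ s → s < r → IsCompact (Metric.closedBall o s)) →
      IsCompact (Metric.closedBall o r) := by
    intro r hr h
    refine TotallyBounded.isCompact_of_isClosed ?_ Metric.isClosed_closedBall
    rw [Metric.totallyBounded_iff]
    intro ε hε
    set s := max 0 (r - ε / 4) with hs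
    have hsr : s < r := max_lt hr (by linarith)
    obtain ⟨t, ht, hcov⟩ := Metric.totallyBounded_iff.1 (h s (le_max_left _ _) hsr).totallyBounded
      (ε / 2) (by linarith)
    refine ⟨t, ht, fun y hy => ?_⟩
    rw [Metric.mem_closedBall, dist_comm] at hy
    have : ∃ z ∈ Metric.closedBall o s, dist y z ≤ ε / 4 := by
      rcases le_total (dist o y) s with h' | h'
      · exact ⟨y, by rwa [Metric.mem_closedBall, dist_comm], by simp; linarith⟩
      · refine ⟨seg o y s, ?_, ?_⟩
        · rw [Metric.mem_closedBall, dist_comm, dist_left_seg (le_max_left _ _) h']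
        · rw [dist_comm, dist_seg_right (le_max_left _ _) h']
          linarith [le_max_right 0 (r - ε / 4)]
    obtain ⟨z, hz, hyz⟩ := this
    have := hcov hz
    simp only [mem_iUnion, Metric.mem_ball] at this ⊢
    obtain ⟨w, hw, hzw⟩ := this
    exact ⟨w, hw, by linarith [dist_triangle y z w]⟩
  -- At the infimum of the radii of noncompact balls, `limit` gives compactness and `grow` extends
  -- it beyond, a contradiction.
  by_contra hcon
  set S := {s : ℝ | 0 ≤ s ∧ ¬ IsCompact (Metric.closedBall o s)} with hS
  have hmono : ∀ {a b : ℝ}, a ≤ b → IsCompact (Metric.closedBall o b) →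
      IsCompact (Metric.closedBall o a) := fun hab hb =>
    hb.of_isClosed_subset Metric.isClosed_closedBall (Metric.closedBall_subset_closedBall hab)
  have h0 : IsCompact (Metric.closedBall o 0) := by
    rw [Metric.closedBall_zero]; exact isCompact_singleton
  have hrS : r ∈ S := ⟨by
    by_contra h; exact hcon (hmono (le_of_not_ge h) h0), hcon⟩
  have hbdd : BddBelow S := ⟨0, fun s hs => hs.1⟩
  set R := sInf S with hR
  have hR0 : 0 ≤ R := le_csInf ⟨r, hrS⟩ fun s hs => hs.1
  have hlt : ∀ s, 0 ≤ s → s < R → IsCompact (Metric.closedBall o s) := by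
    intro s hs hsR
    by_contra h
    exact absurd (csInf_le hbdd (show s ∈ S from ⟨hs, h⟩)) (not_le.2 hsR)
  have hRc : IsCompact (Metric.closedBall o R) := by
    rcases hR0.eq_or_lt with h | h
    · rwa [← h]
    · exact limit R h hlt
  obtain ⟨δ, hδ, hc⟩ := grow R hR0 hRc
  obtain ⟨s, hs, hsR⟩ := exists_lt_of_csInf_lt ⟨r, hrS⟩ (show sInf S < R + δ by linarith)
  exact hs.2 (hmono hsR.le hc)

end Geodesics

/-! ### Geodesic rays: limits, asymptotic rays, rays from a given point. -/

section Rays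

variable {X : Type u} [MetricSpace X]

theorem Ray.dist_eq (ρ : Ray X) (s t : ℝ≥0) : dist (ρ s) (ρ t) = |(s : ℝ) - t| := by
  rw [ρ.isometry.dist_eq, NNReal.dist_eq]

theorem Ray.dist_zero (ρ : Ray X) (t : ℝ≥0) : dist (ρ 0) (ρ t) = t := by
  rw [ρ.dist_eq]; simp

@[ext] theorem Ray.ext {ρ ρ' : Ray X} (h : ∀ t, ρ t = ρ' t) : ρ = ρ' := by
  cases ρ; cases ρ'
  congr
  exact funext h

theorem Ray.endpoint_eq_iff {ρ ρ' : Ray X} : ρ.endpoint = ρ'.endpoint ↔ Asymptotic ρ ρ' :=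
  Quotient.eq (r := raySetoid X)

theorem Boundary.map_endpoint (f : X ≃ᵢ X) (ρ : Ray X) :
    Boundary.map f ρ.endpoint = (ρ.map f).endpoint := rfl

theorem Boundary.map_symm_map (f : X ≃ᵢ X) (ξ : Boundary X) :
    Boundary.map f.symm (Boundary.map f ξ) = ξ := by
  refine Quotient.inductionOn ξ fun ρ => ?_
  change ((ρ.map f).map f.symm).endpoint = ρ.endpoint
  congr 1
  ext t
  exact f.symm_apply_apply _

theorem Boundary.map_map_symm (f : X ≃ᵢ X) (ξ : Boundary X) :
    Boundary.map f (Boundary.map f.symm ξ) = ξ :=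
  Boundary.map_symm_map f.symm ξ

theorem Boundary.map_mul (f g : X ≃ᵢ X) (ξ : Boundary X) :
    Boundary.map (f * g) ξ = Boundary.map f (Boundary.map g ξ) :=
  Quotient.inductionOn ξ fun _ => rfl

theorem Boundary.map_one (ξ : Boundary X) : Boundary.map (1 : X ≃ᵢ X) ξ = ξ :=
  Quotient.inductionOn ξ fun _ => rfl

theorem Boundary.map_inv_map (f : X ≃ᵢ X) (ξ : Boundary X) :
    Boundary.map f⁻¹ (Boundary.map f ξ) = ξ := Boundary.map_symm_map f ξ

theorem Boundary.map_map_inv (f : X ≃ᵢ X) (ξ : Boundary X) :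
    Boundary.map f (Boundary.map f⁻¹ ξ) = ξ := Boundary.map_symm_map f.symm ξ

/-- The ray obtained by forgetting the part of `ρ` before time `s`. -/
def Ray.shift (ρ : Ray X) (s : ℝ≥0) : Ray X :=
  ⟨fun t => ρ (s + t), Isometry.of_dist_eq fun a b => by
    rw [ρ.dist_eq, NNReal.dist_eq]; push_cast; congr 1; ring⟩

theorem tendsto_div_atTop_zero (c : ℝ) :
    Tendsto (fun T : ℝ≥0 => c / (T : ℝ)) atTop (𝓝 0) :=
  Tendsto.const_div_atTop (NNReal.tendsto_coe_atTop.2 tendsto_id) c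

/-- An ultrafilter replaces the diagonal subsequence of Arzelà-Ascoli: for each `t` the points
eventually stay in a compact ball and so converge. -/
theorem exists_ray_tendsto [ProperSpace X] (F : Ultrafilter ℕ) (f : ℕ → ℝ≥0 → X) (o : X) (h0 : ∀ n, f n 0 = o)
    (h : ∀ s t, ∀ᶠ n in (F : Filter ℕ), dist (f n s) (f n t) = dist s t) :
    ∃ ρ : Ray X, ρ 0 = o ∧ ∀ t, Tendsto (fun n => f n t) F (𝓝 (ρ t)) := by
  have hlim : ∀ t, ∃ y, Tendsto (fun n => f n t) F (𝓝 y) := by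
    intro t
    have hb : ∀ᶠ n in (F : Filter ℕ), f n t ∈ Metric.closedBall o (t : ℝ) := by
      filter_upwards [h 0 t] with n hn
      rw [h0, NNReal.dist_eq] at hn
      rw [Metric.mem_closedBall, dist_comm, hn]
      simp
    obtain ⟨y, -, hy⟩ := (isCompact_closedBall o (t : ℝ)).ultrafilter_le_nhds
      (F.map fun n => f n t) (le_principal_iff.2 hb)
    exact ⟨y, hy⟩
  choose g hg using hlim
  refine ⟨⟨g, Isometry.of_dist_eq fun s t => ?_⟩, ?_, hg⟩
  · refine tendsto_nhds_unique ((hg s).dist (hg t)) ?_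
    exact (tendsto_congr' (h s t)).2 tendsto_const_nhds
  · refine tendsto_nhds_unique (hg 0) ?_
    simp only [h0]
    exact tendsto_const_nhds

variable [IsCNSpace X]

theorem Ray.seg_eq (ρ : Ray X) {t T : ℝ≥0} (h : t ≤ T) : seg (ρ 0) (ρ T) t = ρ t := by
  have hT : (t : ℝ) ≤ T := h
  have e := eq_seg (x := ρ 0) (y := ρ T) (m := ρ t) (by
    rw [ρ.dist_zero, ρ.dist_zero, ρ.dist_eq, abs_sub_comm, abs_of_nonneg (by linarith)]
    linarith)
  rw [ρ.dist_zero] at e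
  exact e.symm

theorem Ray.geo_eq (ρ : Ray X) {t T : ℝ≥0} (h : t ≤ T) : geo (ρ 0) (ρ T) (t / T) = ρ t := by
  rw [← ρ.seg_eq h, seg, ρ.dist_zero]

/-- The distance between the two rays is convex and bounded, hence never exceeds its initial value.
-/
theorem dist_ray_le {ρ ρ' : Ray X} (h : ρ.endpoint = ρ'.endpoint) (t : ℝ≥0) :
    dist (ρ t) (ρ' t) ≤ dist (ρ 0) (ρ' 0) := by
  obtain ⟨C, hC⟩ := Ray.endpoint_eq_iff.1 h
  have key : ∀ᶠ T : ℝ≥0 in atTop, dist (ρ t) (ρ' t) ≤ dist (ρ 0) (ρ' 0) + t * C / T := by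
    filter_upwards [eventually_ge_atTop t] with T hT
    have hu := div_mem_unit t.coe_nonneg (show (t : ℝ) ≤ T from hT)
    rw [← ρ.geo_eq hT, ← ρ'.geo_eq hT]
    refine (dist_geo_geo_le _ _ _ _ hu).trans ?_
    have h1 := mul_le_mul_of_nonneg_left (hC T) hu.1
    have h2 := mul_nonneg hu.1 (dist_nonneg (x := ρ 0) (y := ρ' 0))
    have e : (t : ℝ) * C / T = t / T * C := by ring
    rw [e, sub_mul, one_mul]
    linarith
  refine ge_of_tendsto ?_ key
  simpa using (tendsto_div_atTop_zero (t * C)).const_add (dist (ρ 0) (ρ' 0))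

theorem Ray.eq_of_endpoint_eq {ρ ρ' : Ray X} (h : ρ.endpoint = ρ'.endpoint) (h0 : ρ 0 = ρ' 0) :
    ρ = ρ' := by
  ext t
  have := dist_ray_le h t
  rw [h0, dist_self] at this
  exact dist_le_zero.1 this

variable [ProperSpace X]

theorem exists_ray_tendsto_seg (F : Ultrafilter ℕ) (o : X) (y : ℕ → X)
    (hy : Tendsto (fun n => dist o (y n)) F atTop) :
    ∃ ρ : Ray X, ρ 0 = o ∧ ∀ t : ℝ≥0, Tendsto (fun n => seg o (y n) t) F (𝓝 (ρ t)) := by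
  refine exists_ray_tendsto F (fun n t => seg o (y n) t) o (fun n => by simp) fun s t => ?_
  filter_upwards [hy.eventually_ge_atTop (s : ℝ), hy.eventually_ge_atTop (t : ℝ)] with n h1 h2
  rw [dist_seg_seg ⟨s.coe_nonneg, h1⟩ ⟨t.coe_nonneg, h2⟩, NNReal.dist_eq]

/-- The ray is a limit of segments from `p` to `ρ n`. They stay within `2 * dist p (ρ 0)` of `ρ`:
one share by convexity, one for the difference in length. -/
theorem exists_ray_to (p : X) (ξ : Boundary X) : ∃ ρ : Ray X, ρ 0 = p ∧ ρ.endpoint = ξ := by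
  refine Quotient.inductionOn ξ fun ρ => ?_
  have hd : Tendsto (fun n : ℕ => dist p (ρ n)) (hyperfilter ℕ : Ultrafilter ℕ) atTop := by
    have h1 : Tendsto (fun n : ℕ => (n : ℝ) - dist p (ρ 0)) (hyperfilter ℕ) atTop :=
      (tendsto_atTop_add_const_right _ _ tendsto_natCast_atTop_atTop).mono_left
        Nat.hyperfilter_le_atTop
    refine tendsto_atTop_mono (fun n => ?_) h1
    have h2 := dist_triangle (ρ 0) p (ρ n)
    rw [ρ.dist_zero, dist_comm (ρ 0)] at h2
    simp only [NNReal.coe_natCast] at h2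
    linarith
  obtain ⟨ρ', h0, hlim⟩ := exists_ray_tendsto_seg _ p (fun n : ℕ => ρ n) hd
  refine ⟨ρ', h0, Ray.endpoint_eq_iff.2 ⟨2 * dist p (ρ 0), fun t => ?_⟩⟩
  refine le_of_tendsto ((hlim t).dist (tendsto_const_nhds (x := ρ t))) ?_
  obtain ⟨N, hN⟩ := exists_nat_ge (t : ℝ)
  filter_upwards [hd.eventually_ge_atTop (t : ℝ), Nat.hyperfilter_le_atTop
    (eventually_ge_atTop (N + 1))] with n hn hNn
  have htn : (t : ℝ) ≤ (n : ℝ≥0) := hN.trans (by exact_mod_cast (Nat.le_succ N).trans hNn)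
  have hn0 : (0 : ℝ) < n := by exact_mod_cast (Nat.succ_pos N).trans_le hNn
  set w : ℝ := (t : ℝ) / (n : ℝ≥0) with hw
  have hu : w ∈ Icc (0 : ℝ) 1 := div_mem_unit t.coe_nonneg htn
  have hwn : w * n = t := div_mul_self_of_le t.coe_nonneg htn
  have e : geo (ρ 0) (ρ n) w = ρ t := ρ.geo_eq htn
  have h1 : dist (geo p (ρ n) w) (ρ t) ≤ dist p (ρ 0) := by
    rw [← e]
    refine (dist_geo_geo_right_le _ _ _ hu).trans ?_
    exact mul_le_of_le_one_left dist_nonneg (by linarith [hu.1])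
  have h2 : dist (seg p (ρ n) t) (geo p (ρ n) w) ≤ dist p (ρ 0) := by
    have hpos : 0 < dist p (ρ n) ∨ dist p (ρ n) = 0 := by
      rcases (dist_nonneg (x := p) (y := ρ n)).eq_or_lt with h | h
      · exact Or.inr h.symm
      · exact Or.inl h
    have e2 : geo p (ρ n) w = seg p (ρ n) (w * dist p (ρ n)) := by
      rcases hpos with h | h
      · rw [seg, mul_div_assoc, div_self h.ne', mul_one]
      · rw [h, mul_zero, seg_zero]
        have h' := dist_left_geo p (ρ n) hu
        rw [h, mul_zero] at h'
        exact (dist_eq_zero.1 h').symm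
    rw [e2, dist_seg_seg ⟨t.coe_nonneg, hn⟩ ⟨mul_nonneg hu.1 dist_nonneg,
      mul_le_of_le_one_left dist_nonneg hu.2⟩]
    rw [← hwn, ← mul_sub, abs_mul, abs_of_nonneg hu.1]
    refine (mul_le_of_le_one_left (abs_nonneg _) hu.2).trans ?_
    have := abs_dist_sub_le (ρ 0) p (ρ n)
    rw [ρ.dist_zero, dist_comm (ρ 0) p] at this
    simpa using this
  calc dist (seg p (ρ n) t) (ρ t) ≤ _ := dist_triangle _ (geo p (ρ n) w) _
    _ ≤ _ := by linarith

/-- The ray from `p` to the boundary point `ξ`. -/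
noncomputable def rayTo (p : X) (ξ : Boundary X) : Ray X := (exists_ray_to p ξ).choose

@[simp] theorem rayTo_zero (p : X) (ξ : Boundary X) : rayTo p ξ 0 = p :=
  (exists_ray_to p ξ).choose_spec.1

@[simp] theorem rayTo_endpoint (p : X) (ξ : Boundary X) : (rayTo p ξ).endpoint = ξ :=
  (exists_ray_to p ξ).choose_spec.2

theorem eq_rayTo {ρ : Ray X} {p : X} {ξ : Boundary X} (h0 : ρ 0 = p) (h : ρ.endpoint = ξ) :
    ρ = rayTo p ξ :=
  Ray.eq_of_endpoint_eq (by rw [h, rayTo_endpoint]) (by rw [h0, rayTo_zero])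

theorem dist_left_rayTo (p : X) (ξ : Boundary X) (t : ℝ≥0) : dist p (rayTo p ξ t) = t := by
  have := (rayTo p ξ).dist_zero t
  rwa [rayTo_zero] at this

theorem dist_rayTo_rayTo_le (p q : X) (ξ : Boundary X) (t : ℝ≥0) :
    dist (rayTo p ξ t) (rayTo q ξ t) ≤ dist p q := by
  have := dist_ray_le (ρ := rayTo p ξ) (ρ' := rayTo q ξ) (by simp) t
  simpa using this

theorem map_rayTo (f : X ≃ᵢ X) (p : X) (ξ : Boundary X) (t : ℝ≥0) :
    f (rayTo p ξ t) = rayTo (f p) (Boundary.map f ξ) t := by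
  have : (rayTo p ξ).map f = rayTo (f p) (Boundary.map f ξ) := by
    refine eq_rayTo ?_ ?_
    · change f (rayTo p ξ 0) = f p
      rw [rayTo_zero]
    · rw [← Boundary.map_endpoint, rayTo_endpoint]
  rw [← this]; rfl

theorem seg_rayTo (p : X) (ξ : Boundary X) {t T : ℝ≥0} (h : t ≤ T) :
    seg p (rayTo p ξ T) t = rayTo p ξ t := by
  have := (rayTo p ξ).seg_eq h
  rwa [rayTo_zero] at this

theorem tendsto_seg_ray (p : X) (ρ : Ray X) (t : ℝ≥0) :
    Tendsto (fun T : ℝ≥0 => seg p (ρ T) t) atTop (𝓝 (rayTo p ρ.endpoint t)) := by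
  have hr := fun T => dist_ray_le (ρ := rayTo p ρ.endpoint) (ρ' := ρ) (by simp) T
  rw [rayTo_zero] at hr
  set r := dist p (ρ 0) with hrdef
  rw [tendsto_iff_dist_tendsto_zero]
  refine squeeze_zero' (Eventually.of_forall fun _ => dist_nonneg) ?_
    (tendsto_div_atTop_zero (2 * t * r))
  filter_upwards [eventually_ge_atTop (t + ⟨r, dist_nonneg⟩)] with T hT
  have hT' : (t : ℝ) + r ≤ T := hT
  have hr0 : 0 ≤ r := dist_nonneg
  have htT : t ≤ T := by
    have : (t : ℝ) ≤ T := by linarith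
    exact this
  rw [dist_comm, ← seg_rayTo p ρ.endpoint htT]
  have h1 := dist_triangle p (ρ T) (rayTo p ρ.endpoint T)
  rw [dist_left_rayTo, dist_comm (ρ T)] at h1
  refine (dist_seg_seg_left_le t.coe_nonneg (by rw [dist_left_rayTo]; exact htT) ?_).trans ?_
  · have := hr T
    change (t : ℝ) ≤ _
    linarith
  · rw [dist_left_rayTo]
    have := hr T
    change 2 * (t : ℝ) * _ / _ ≤ _
    gcongr

end Rays

/-! ### Neighbourhood bases of the cone topology and the action of isometries. -/

section ConeTopology

variable {X : Type u} [MetricSpace X]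

/-- A point of `X ∪ ∂X` is outside of the closed ball of radius `R` about `o`. -/
def IsFar (o : X) (R : ℝ≥0) : Compactification X → Prop
  | .pt y => (R : ℝ) < dist o y
  | .bd _ => True

theorem IsFar.mono {o : X} {R R' : ℝ≥0} (h : R ≤ R') {z : Compactification X} (hz : IsFar o R' z) :
    IsFar o R z := by
  cases z with
  | pt y => exact lt_of_le_of_lt (NNReal.coe_le_coe.2 h) hz
  | bd η => trivial

/-- The action of an isometry on `X ∪ ∂X`. -/
def Compactification.map (f : X ≃ᵢ X) : Compactification X → Compactification X
  | .pt y => .pt (f y)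
  | .bd ξ => .bd (Boundary.map f ξ)

theorem isFar_map (f : X ≃ᵢ X) {o : X} {R : ℝ≥0} {z : Compactification X} :
    IsFar (f o) R (z.map f) ↔ IsFar o R z := by
  cases z with
  | pt y => change _ < dist (f o) (f y) ↔ _ < dist o y; rw [f.isometry.dist_eq]
  | bd _ => exact Iff.rfl

variable [IsCNSpace X] [ProperSpace X]

/-- The point at time `R` on the geodesic from `o` to a point of `X ∪ ∂X`. -/
noncomputable def toward (o : X) : Compactification X → ℝ≥0 → X
  | .pt y, R => seg o y R
  | .bd ξ, R => rayTo o ξ R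

theorem mem_coneNhd {o : X} {ξ : Boundary X} {R : ℝ≥0} {ε : ℝ} {z : Compactification X} :
    z ∈ coneNhd o ξ R ε ↔ IsFar o R z ∧ dist (toward o z R) (rayTo o ξ R) < ε := by
  cases z with
  | pt y =>
    constructor
    · rintro ⟨ρ, h0, he, hf, σ, l, hσ, hd⟩
      obtain rfl := eq_rayTo h0 he
      have hl := hσ.length_eq
      rw [hσ.eq_seg ⟨R.coe_nonneg, by rw [hl]; exact hf.le⟩] at hd
      exact ⟨hf, hd⟩
    · rintro ⟨hf, hd⟩
      exact ⟨rayTo o ξ, by simp, by simp, hf, seg o y, _, isGeodesicPath_seg o y, hd⟩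
  | bd η =>
    constructor
    · rintro ⟨ρ, h0, he, ρ', h0', he', hd⟩
      obtain rfl := eq_rayTo h0 he
      obtain rfl := eq_rayTo h0' he'
      exact ⟨trivial, hd⟩
    · rintro ⟨-, hd⟩
      exact ⟨rayTo o ξ, by simp, by simp, rayTo o η, by simp, by simp, hd⟩

theorem IsFar.dist_toward {o : X} {R : ℝ≥0} {z : Compactification X} (hz : IsFar o R z) :
    dist o (toward o z R) = R := by
  cases z with
  | pt y => exact dist_left_seg R.coe_nonneg (le_of_lt hz)
  | bd η => exact dist_left_rayTo _ _ _

theorem IsFar.seg_toward {o : X} {R R' : ℝ≥0} (h : R ≤ R') {z : Compactification X}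
    (hz : IsFar o R' z) : seg o (toward o z R') R = toward o z R := by
  cases z with
  | pt y => exact seg_seg R.coe_nonneg h (le_of_lt hz)
  | bd η => exact seg_rayTo o η h

theorem dist_toward_le {o : X} {R R' : ℝ≥0} (h : R ≤ R') {z w : Compactification X}
    (hz : IsFar o R' z) (hw : IsFar o R' w) :
    dist (toward o z R) (toward o w R) ≤ R / R' * dist (toward o z R') (toward o w R') := by
  rw [← hz.seg_toward h, ← hw.seg_toward h, seg, seg, hz.dist_toward, hw.dist_toward]
  exact dist_geo_geo_left_le _ _ _ (div_mem_unit R.coe_nonneg h)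

theorem dist_toward_mono {o : X} {R R' : ℝ≥0} (h : R ≤ R') {z w : Compactification X}
    (hz : IsFar o R' z) (hw : IsFar o R' w) :
    dist (toward o z R) (toward o w R) ≤ dist (toward o z R') (toward o w R') :=
  (dist_toward_le h hz hw).trans
    (mul_le_of_le_one_left dist_nonneg (div_mem_unit R.coe_nonneg (NNReal.coe_le_coe.2 h)).2)

theorem coneNhd_anti (o : X) (ξ : Boundary X) {R R' : ℝ≥0} (h : R ≤ R') (ε : ℝ) :
    coneNhd o ξ R' ε ⊆ coneNhd o ξ R ε := by
  intro z hz
  rw [mem_coneNhd] at hz ⊢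
  refine ⟨hz.1.mono h, lt_of_le_of_lt ?_ hz.2⟩
  exact dist_toward_mono h hz.1 (w := .bd ξ) trivial

/-- Change of base point for the geodesics to a point of `X ∪ ∂X`. -/
theorem dist_toward_seg_le {o y : X} {r : ℝ} (hr : dist o y ≤ r) {R R' : ℝ≥0}
    (h0 : (0 : ℝ) < R' - 2 * r) (h : (R : ℝ) ≤ R' - 2 * r) {z : Compactification X}
    (hz : IsFar o R' z) :
    dist (toward y z R) (seg y (toward o z R') R) ≤ 2 * R * r / (R' - 2 * r) := by
  have hr0 : 0 ≤ r := dist_nonneg.trans hr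
  have hD : R' - r ≤ dist y (toward o z R') := by
    have h1 := dist_triangle o y (toward o z R')
    rw [hz.dist_toward] at h1
    linarith
  have e : (R' : ℝ) - 2 * r = R' - r - r := by ring
  rw [e] at h h0 ⊢
  cases z with
  | pt w =>
    set s : ℝ := R' / dist o w with hs
    have hu : s ∈ Icc (0 : ℝ) 1 := div_mem_unit R'.coe_nonneg (le_of_lt hz)
    refine dist_seg_seg_le_of_near (b := geo y w s) ?_ ?_ hD R.coe_nonneg h h0
    · rw [dist_left_geo _ _ hu, dist_geo_right _ _ hu]; linarith
    · refine (dist_geo_geo_right_le _ _ _ hu).trans ?_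
      rw [dist_comm]
      exact (mul_le_of_le_one_left dist_nonneg (by linarith [hu.1])).trans hr
  | bd η =>
    have hRR : R ≤ R' := by
      have : (R : ℝ) ≤ R' := by linarith
      exact this
    change dist (rayTo y η R) _ ≤ _
    rw [← seg_rayTo y η hRR]
    refine dist_seg_seg_le_of_near (b := rayTo y η R') (by simp) ?_ hD R.coe_nonneg h h0
    exact (dist_rayTo_rayTo_le _ _ _ _).trans (by rwa [dist_comm])

/-- This makes the cone topology independent of the base point. The width can be fixed at 1, since
at a fixed earlier time geodesics that are 1-close at time `R'` get arbitrarily close as `R'` grows.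
-/
theorem exists_coneNhd_subset {y : X} {η ξ : Boundary X} {R : ℝ≥0} {ε : ℝ}
    (h : Compactification.bd ξ ∈ coneNhd y η R ε) (o : X) :
    ∃ R' : ℝ≥0, coneNhd o ξ R' 1 ⊆ coneNhd y η R ε := by
  rw [mem_coneNhd] at h
  change True ∧ dist (rayTo y ξ R) _ < ε at h
  set r := dist o y
  have hr0 : 0 ≤ r := dist_nonneg
  set δ := ε - dist (rayTo y ξ R) (rayTo y η R)
  have hδ : 0 < δ := sub_pos.2 h.2
  have hR0 : (0 : ℝ) ≤ R := R.coe_nonneg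
  have hq : 0 ≤ (4 * R * r + 2 * R) / δ := by positivity
  set M : ℝ := R + 1 + (4 * R * r + 2 * R) / δ with hM
  have hMpos : 0 < M := by positivity
  have hMδ : (4 * R * r + 2 * R) / M < δ := by
    rw [div_lt_iff₀ hMpos, hM, mul_add, mul_div_cancel₀ _ hδ.ne']
    nlinarith
  refine ⟨⟨M + 2 * r, by positivity⟩, fun z hz => ?_⟩
  set R' : ℝ≥0 := ⟨M + 2 * r, by positivity⟩ with hR'
  have eR' : (R' : ℝ) - 2 * r = M := by change M + 2 * r - 2 * r = M; ring
  have eR'' : (R' : ℝ) = M + 2 * r := rfl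
  rw [mem_coneNhd] at hz ⊢
  have hRM : (R : ℝ) ≤ M := by linarith
  constructor
  · cases z with
    | pt w =>
      have h1 : (R' : ℝ) < dist o w := hz.1
      have := dist_triangle o y w
      change (R : ℝ) < dist y w
      change dist o w ≤ r + _ at this
      linarith
    | bd _ => trivial
  · have a1 := dist_toward_seg_le (le_refl r) (R := R) (R' := R') (by rw [eR']; exact hMpos)
      (by rw [eR']; exact hRM) hz.1
    have a2 := dist_toward_seg_le (le_refl r) (R := R) (R' := R') (by rw [eR']; exact hMpos)
      (by rw [eR']; exact hRM) (z := .bd ξ) trivial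
    rw [eR'] at a1 a2
    set A := toward o z R'
    set A' := toward o (.bd ξ) R'
    have hA : dist o A = R' := hz.1.dist_toward
    have hA' : dist o A' = R' := dist_left_rayTo _ _ _
    have yA : M ≤ dist y A := by
      have := dist_triangle o y A
      change dist o A ≤ r + _ at this
      linarith
    have yA' : M ≤ dist y A' := by
      have := dist_triangle o y A'
      change dist o A' ≤ r + _ at this
      linarith
    have a3 : dist (seg y A R) (seg y A' R) ≤ 2 * R * 1 / M := by
      refine (dist_seg_seg_left_le R.coe_nonneg (hRM.trans yA) (hRM.trans yA')).trans ?_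
      have := hz.2.le
      change dist A A' ≤ 1 at this
      exact div_le_div₀ (by positivity) (mul_le_mul_of_nonneg_left this (by positivity)) hMpos yA
    have t1 := dist_triangle (toward y z R) (seg y A R) (rayTo y η R)
    have t2 := dist_triangle (seg y A R) (seg y A' R) (rayTo y η R)
    have t3 := dist_triangle (seg y A' R) (rayTo y ξ R) (rayTo y η R)
    rw [dist_comm] at a2
    change dist (seg y A' R) (rayTo y ξ R) ≤ _ at a2
    have e : (4 * R * r + 2 * R) / M = 2 * R * r / M + 2 * R * r / M + 2 * R * 1 / M := by ring
    have : δ = ε - dist (rayTo y ξ R) (rayTo y η R) := rfl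
    linarith

theorem coneNhd_mem_nhds (o : X) (ξ : Boundary X) (R : ℝ≥0) {ε : ℝ} (hε : 0 < ε) :
    coneNhd o ξ R ε ∈ 𝓝 (Compactification.bd ξ) := by
  refine IsOpen.mem_nhds (TopologicalSpace.isOpen_generateFrom_of_mem
    (Or.inr ⟨o, ξ, R, ε, hε, rfl⟩)) ?_
  rw [mem_coneNhd]
  exact ⟨trivial, by simpa [toward] using hε⟩

theorem exists_coneNhd_subset_of_mem_nhds (o : X) {ξ : Boundary X} {U : Set (Compactification X)}
    (hU : U ∈ 𝓝 (Compactification.bd ξ)) : ∃ R : ℝ≥0, coneNhd o ξ R 1 ⊆ U := by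
  have hle : ⨅ R : ℝ≥0, 𝓟 (coneNhd o ξ R 1) ≤ 𝓝 (Compactification.bd ξ) := by
    rw [TopologicalSpace.nhds_generateFrom]
    refine le_iInf₂ fun s hs => ?_
    obtain ⟨hξ, ⟨V, -, rfl⟩ | ⟨y, η, R, ε, -, rfl⟩⟩ := hs
    -- The generators that are open subsets of `X` contain no boundary point.
    · obtain ⟨v, -, hv⟩ := hξ
      cases hv
    · obtain ⟨R', hR'⟩ := exists_coneNhd_subset hξ o
      exact le_principal_iff.2 (mem_iInf_of_mem R' (mem_principal.2 hR'))
  have := hle hU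
  rw [mem_iInf_of_directed] at this
  · obtain ⟨R, hR⟩ := this
    exact ⟨R, hR⟩
  · intro R R'
    exact ⟨max R R', principal_mono.2 (coneNhd_anti o ξ (le_max_left _ _) 1),
      principal_mono.2 (coneNhd_anti o ξ (le_max_right _ _) 1)⟩

theorem mem_nhds_boundary (o : X) (ξ : Boundary X) (R : ℝ≥0) {ε : ℝ} (hε : 0 < ε) :
    {η | dist (rayTo o η R) (rayTo o ξ R) < ε} ∈ 𝓝 ξ := by
  rw [nhds_induced]
  refine ⟨_, coneNhd_mem_nhds o ξ R hε, fun η hη => ?_⟩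
  exact (mem_coneNhd.1 (show Compactification.bd η ∈ _ from hη)).2

theorem exists_subset_of_mem_nhds_boundary (o : X) {ξ : Boundary X} {U : Set (Boundary X)}
    (hU : U ∈ 𝓝 ξ) : ∃ R : ℝ≥0, ∀ η, dist (rayTo o η R) (rayTo o ξ R) < 1 → η ∈ U := by
  rw [nhds_induced] at hU
  obtain ⟨V, hV, hVU⟩ := hU
  obtain ⟨R, hR⟩ := exists_coneNhd_subset_of_mem_nhds o hV
  exact ⟨R, fun η hη => hVU (hR (mem_coneNhd.2 ⟨trivial, hη⟩))⟩

theorem toward_map (f : X ≃ᵢ X) {o : X} {R : ℝ≥0} {z : Compactification X} (hz : IsFar o R z) :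
    toward (f o) (z.map f) R = f (toward o z R) := by
  cases z with
  | pt y => exact (map_seg f o y R.coe_nonneg (le_of_lt hz)).symm
  | bd ξ => exact (map_rayTo f o ξ R).symm

theorem map_mem_coneNhd_iff (f : X ≃ᵢ X) {o : X} {ξ : Boundary X} {R : ℝ≥0} {ε : ℝ}
    {z : Compactification X} :
    z.map f ∈ coneNhd (f o) (Boundary.map f ξ) R ε ↔ z ∈ coneNhd o ξ R ε := by
  rw [mem_coneNhd, mem_coneNhd, isFar_map]
  refine and_congr_right fun hz => ?_
  rw [toward_map f hz, ← map_rayTo, f.isometry.dist_eq]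

theorem continuous_compactification_map (f : X ≃ᵢ X) :
    Continuous (Compactification.map f) := by
  refine continuous_generateFrom_iff.2 ?_
  rintro s (⟨V, hV, rfl⟩ | ⟨y, η, R, ε, hε, rfl⟩)
  · refine TopologicalSpace.isOpen_generateFrom_of_mem
      (Or.inl ⟨f ⁻¹' V, hV.preimage f.continuous, ?_⟩)
    ext z
    cases z with
    | pt y => simp [Compactification.map]
    | bd _ => simp [Compactification.map]
  · refine TopologicalSpace.isOpen_generateFrom_of_mem
      (Or.inr ⟨f.symm y, Boundary.map f.symm η, R, ε, hε, ?_⟩)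
    ext z
    rw [← map_mem_coneNhd_iff f, Boundary.map_map_symm, f.apply_symm_apply]
    rfl

theorem continuous_boundary_map (f : X ≃ᵢ X) : Continuous (Boundary.map f) :=
  continuous_induced_rng.2
    ((continuous_compactification_map f).comp (continuous_induced_dom (f := Compactification.bd)))

end ConeTopology

/-! ### Busemann functions. -/

section Busemann

variable {X : Type u} [MetricSpace X]

/-- The Busemann function of a ray. -/
noncomputable def busemann (ρ : Ray X) (x : X) : ℝ := ⨅ T : ℝ≥0, (dist x (ρ T) - T)

theorem tendsto_busemann (ρ : Ray X) (x : X) :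
    Tendsto (fun T : ℝ≥0 => dist x (ρ T) - T) atTop (𝓝 (busemann ρ x)) := by
  refine tendsto_atTop_ciInf ?_ ?_
  · intro S T h
    have h1 := dist_triangle x (ρ S) (ρ T)
    have hST : (S : ℝ) ≤ T := h
    rw [ρ.dist_eq, abs_sub_comm, abs_of_nonneg (by linarith)] at h1
    change dist x (ρ T) - T ≤ dist x (ρ S) - S
    linarith
  · refine ⟨-dist x (ρ 0), ?_⟩
    rintro _ ⟨T, rfl⟩
    have h1 := dist_triangle (ρ 0) x (ρ T)
    rw [ρ.dist_zero, dist_comm (ρ 0)] at h1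
    change _ ≤ dist x (ρ T) - T
    linarith

theorem busemann_le_add (ρ : Ray X) (x y : X) : busemann ρ x ≤ busemann ρ y + dist x y := by
  refine le_of_tendsto_of_tendsto' (tendsto_busemann ρ x)
    ((tendsto_busemann ρ y).add_const _) fun T => ?_
  linarith [dist_triangle x y (ρ T)]

theorem tendsto_dist_ray_atTop (ρ : Ray X) (x : X) :
    Tendsto (fun T : ℝ≥0 => dist x (ρ T)) atTop atTop := by
  have h := (tendsto_busemann ρ x).add_atTop (NNReal.tendsto_coe_atTop.2 tendsto_id)
  simpa using h

variable [IsCNSpace X] [ProperSpace X]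

theorem busemann_rayTo (ρ : Ray X) (p : X) (S : ℝ≥0) :
    busemann ρ (rayTo p ρ.endpoint S) = busemann ρ p - S := by
  refine le_antisymm ?_ ?_
  · have h1 : Tendsto (fun T : ℝ≥0 => dist (rayTo p ρ.endpoint S) (seg p (ρ T) S) +
        (dist p (ρ T) - T - S)) atTop (𝓝 (0 + (busemann ρ p - S))) := by
      refine Tendsto.add ?_ ((tendsto_busemann ρ p).sub_const _)
      have := (tendsto_iff_dist_tendsto_zero.1 (tendsto_seg_ray p ρ S))
      simpa only [dist_comm] using this
    rw [zero_add] at h1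
    refine le_of_tendsto_of_tendsto (tendsto_busemann ρ _) h1 ?_
    filter_upwards [(tendsto_dist_ray_atTop ρ p).eventually_ge_atTop (S : ℝ)] with T hT
    have h2 := dist_seg_right S.coe_nonneg hT
    have h3 := dist_triangle (rayTo p ρ.endpoint S) (seg p (ρ T) S) (ρ T)
    linarith
  · have := busemann_le_add ρ p (rayTo p ρ.endpoint S)
    rw [dist_left_rayTo] at this
    linarith

/-- The convexity inequality on the segment from `p` to `ρ T`, in the limit of large `T`: the
difference of the squared distances to `ρ T`, divided by `dist p (ρ T)`, tends to twice the Busemann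
difference. It acts as a law of cosines with vertex `p`. -/
theorem dist_rayTo_sq_le (ρ : Ray X) (x p : X) (S : ℝ≥0) :
    dist x (rayTo p ρ.endpoint S) ^ 2 ≤
      dist x p ^ 2 + S ^ 2 + 2 * S * (busemann ρ x - busemann ρ p) := by
  have hl := tendsto_dist_ray_atTop ρ p
  have hinv : Tendsto (fun T : ℝ≥0 => (dist p (ρ T))⁻¹) atTop (𝓝 0) :=
    tendsto_inv_atTop_zero.comp hl
  have hdiff : Tendsto (fun T : ℝ≥0 => dist x (ρ T) - dist p (ρ T)) atTop
      (𝓝 (busemann ρ x - busemann ρ p)) := by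
    have := (tendsto_busemann ρ x).sub (tendsto_busemann ρ p)
    simpa using this
  have hr : Tendsto (fun T : ℝ≥0 => (1 - S * (dist p (ρ T))⁻¹) * dist x p ^ 2 +
      S * ((dist x (ρ T) - dist p (ρ T)) *
        (2 + (dist x (ρ T) - dist p (ρ T)) * (dist p (ρ T))⁻¹)) + S ^ 2) atTop
      (𝓝 ((1 - S * 0) * dist x p ^ 2 + S * ((busemann ρ x - busemann ρ p) *
        (2 + (busemann ρ x - busemann ρ p) * 0)) + S ^ 2)) :=
    ((((hinv.const_mul _).const_sub 1).mul_const _).add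
      ((hdiff.mul ((hdiff.mul hinv).const_add 2)).const_mul _)).add_const _
  have hlim := ((tendsto_const_nhds (x := x)).dist (tendsto_seg_ray p ρ S)).pow 2
  have := le_of_tendsto_of_tendsto hlim hr ?_
  · refine this.trans (le_of_eq ?_)
    ring
  · filter_upwards [hl.eventually_ge_atTop (S : ℝ), hl.eventually_gt_atTop 0] with T hT h0
    have h1 := dist_seg_sq_sub_le x p (ρ T) S.coe_nonneg hT
    refine (sub_le_iff_le_add.1 h1).trans (le_of_eq ?_)
    field_simp
    ring

end Busemann

/-! ### Rigidity: an upper sector bound forces a flat half-plane. -/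

section HalfPlane

variable {X : Type u} [MetricSpace X]

/-- If `f` lies below a linear function, vanishes at the origin, and is midpoint convex with respect
to the origin, then it is linear. -/
theorem eq_linear_of_le {f : ℝ → ℝ} {b : ℝ} (hmid : ∀ u, 0 ≤ f u + f (-u))
    (hle : ∀ u, f u ≤ b * u) (u : ℝ) : f u = b * u := by
  have h1 := hmid u
  have h2 := hle (-u)
  have h3 := hle u
  linarith

theorem isometry_shift {σ : ℝ → X} (hσ : Isometry σ) (t : ℝ) : Isometry fun u => σ (t + u) :=
  hσ.comp (isometry_add_left t)

variable [IsCNSpace X]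

theorem line_eq_geo {σ : ℝ → X} (hσ : Isometry σ) (u v : ℝ) {s : ℝ} (hs : s ∈ Icc (0 : ℝ) 1) :
    σ ((1 - s) * u + s * v) = geo (σ u) (σ v) s := by
  refine eq_geo hs ?_ ?_
  · rw [hσ.dist_eq, hσ.dist_eq, Real.dist_eq, Real.dist_eq]
    refine le_of_eq ?_
    have : u - ((1 - s) * u + s * v) = s * (u - v) := by ring
    rw [this, abs_mul, abs_of_nonneg hs.1]
  · rw [hσ.dist_eq, hσ.dist_eq, Real.dist_eq, Real.dist_eq]
    refine le_of_eq ?_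
    have : (1 - s) * u + s * v - v = (1 - s) * (u - v) := by ring
    rw [this, abs_mul, abs_of_nonneg (by linarith [hs.2])]

theorem dist_line_sq_convex {σ : ℝ → X} (hσ : Isometry σ) (p : X) (u v : ℝ) {s : ℝ}
    (hs : s ∈ Icc (0 : ℝ) 1) :
    dist p (σ ((1 - s) * u + s * v)) ^ 2 - ((1 - s) * u + s * v) ^ 2 ≤
      (1 - s) * (dist p (σ u) ^ 2 - u ^ 2) + s * (dist p (σ v) ^ 2 - v ^ 2) := by
  have h := dist_geo_sq_le p (σ u) (σ v) hs
  rw [← line_eq_geo hσ u v hs, hσ.dist_eq, Real.dist_eq, sq_abs] at h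
  nlinarith

/-- The point `ρ S` of a ray starting at `σ 0` is at most as far from the line `σ` as in a flat
sector in which `m` is minus the cosine of the angle between the ray and the line. -/
def SectorBound (σ : ℝ → X) (ρ : Ray X) (m : ℝ) : Prop :=
  ∀ (u : ℝ) (S : ℝ≥0), dist (σ u) (ρ S) ^ 2 ≤ u ^ 2 + S ^ 2 + 2 * m * u * S

theorem SectorBound.zero {X : Type u} [MetricSpace X] {σ : ℝ → X} {ρ : Ray X} {m : ℝ}
    (h : SectorBound σ ρ m) : ρ 0 = σ 0 := by
  have := h 0 0
  simp at this
  exact this.symm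

/-- Along a line the squared distance minus `u ^ 2` is convex; a convex function touching a linear
upper bound at `u = 0` agrees with it. -/
theorem SectorBound.eq {σ : ℝ → X} (hσ : Isometry σ) {ρ : Ray X} {m : ℝ}
    (h : SectorBound σ ρ m) (u : ℝ) (S : ℝ≥0) :
    dist (σ u) (ρ S) ^ 2 = u ^ 2 + S ^ 2 + 2 * m * u * S := by
  have h0 : dist (ρ S) (σ 0) = S := by rw [← h.zero, dist_comm, ρ.dist_zero]
  have := eq_linear_of_le (f := fun u => dist (ρ S) (σ u) ^ 2 - u ^ 2 - S ^ 2) (b := 2 * m * S)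
    (fun u => by
      have := dist_line_sq_convex hσ (ρ S) u (-u) (s := 1 / 2) (by constructor <;> norm_num)
      have e : (1 - 1 / 2) * u + 1 / 2 * -u = 0 := by ring
      rw [e, h0] at this
      linarith)
    (fun u => by
      have := h u S
      rw [dist_comm]
      linarith) u
  rw [dist_comm]
  linarith

theorem SectorBound.busemann_line {σ : ℝ → X} (hσ : Isometry σ) {ρ : Ray X} {m : ℝ}
    (h : SectorBound σ ρ m) (u : ℝ) : busemann ρ (σ u) = m * u := by
  have h1 := tendsto_busemann ρ (σ u)
  have h2 := tendsto_div_atTop_zero 1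
  have h3 : Tendsto (fun T : ℝ≥0 => (dist (σ u) (ρ T) - T) *
      ((dist (σ u) (ρ T) - T) * (1 / T) + 2)) atTop
      (𝓝 (busemann ρ (σ u) * (busemann ρ (σ u) * 0 + 2))) :=
    h1.mul ((h1.mul h2).add_const _)
  have h4 : Tendsto (fun T : ℝ≥0 => u ^ 2 * (1 / T) + 2 * m * u) atTop
      (𝓝 (u ^ 2 * 0 + 2 * m * u)) := (h2.const_mul _).add_const _
  have h5 := tendsto_nhds_unique_of_eventuallyEq h3 h4 (by
    filter_upwards [eventually_gt_atTop 0] with T hT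
    have hT' : (0 : ℝ) < T := hT
    have e := h.eq hσ u T
    field_simp
    linarith)
  linarith

variable [ProperSpace X]

/-- The Busemann function is linear on `σ`, so the same bound holds at every base point on the line.
-/
theorem SectorBound.move {σ : ℝ → X} (hσ : Isometry σ) {ρ : Ray X} {m : ℝ}
    (h : SectorBound σ ρ m) (t : ℝ) :
    SectorBound (fun u => σ (t + u)) (rayTo (σ t) ρ.endpoint) m := by
  intro u S
  have h1 := dist_rayTo_sq_le ρ (σ (t + u)) (σ t) S
  rw [h.busemann_line hσ, h.busemann_line hσ, hσ.dist_eq, Real.dist_eq, sq_abs] at h1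
  refine h1.trans (le_of_eq ?_)
  ring

theorem SectorBound.dist_sq_le {σ : ℝ → X} (hσ : Isometry σ) {ρ : Ray X} {m : ℝ}
    (h : SectorBound σ ρ m) (t t' : ℝ) (S S' : ℝ≥0) :
    dist (rayTo (σ t) ρ.endpoint S) (rayTo (σ t') ρ.endpoint S') ^ 2 ≤
      (t' - t) ^ 2 + ((S : ℝ) - S') ^ 2 + 2 * m * (t' - t) * (S - S') := by
  have h1 := dist_rayTo_sq_le ρ (rayTo (σ t) ρ.endpoint S) (σ t') S'
  have h2 := (h.move hσ t).eq (isometry_shift hσ t) (t' - t) S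
  simp only [add_sub_cancel] at h2
  rw [busemann_rayTo, h.busemann_line hσ, h.busemann_line hσ, dist_comm _ (σ t'), h2] at h1
  refine h1.trans (le_of_eq ?_)
  ring

/-- Both points are compared with a far point `σ T`: their distances to it differ by nearly `t' -
t`, and the triangle inequality bounds this difference by their mutual distance. -/
theorem SectorBound.le_dist {σ : ℝ → X} (hσ : Isometry σ) {ρ : Ray X} {m : ℝ}
    (h : SectorBound σ ρ m) {t t' : ℝ} (htt : t ≤ t') (S : ℝ≥0) :
    t' - t ≤ dist (rayTo (σ t) ρ.endpoint S) (rayTo (σ t') ρ.endpoint S) := by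
  set x := rayTo (σ t) ρ.endpoint S
  set w := rayTo (σ t') ρ.endpoint S
  set d := dist x w
  have hd : 0 ≤ d := dist_nonneg
  have key : ∀ T : ℝ, t' ≤ T → (t' - t) * (2 * T - t - t' + 2 * m * S) ≤
      d * (2 * T - t - t' + 2 * S) := by
    intro T hT
    have e1 := (h.move hσ t).eq (isometry_shift hσ t) (T - t) S
    have e2 := (h.move hσ t').eq (isometry_shift hσ t') (T - t') S
    simp only [add_sub_cancel] at e1 e2
    have a1 : dist (σ T) x ≤ (T - t) + S := by
      refine (dist_triangle _ (σ t) _).trans (le_of_eq ?_)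
      rw [dist_left_rayTo, hσ.dist_eq, Real.dist_eq, abs_of_nonneg (by linarith)]
    have a2 : dist (σ T) w ≤ (T - t') + S := by
      refine (dist_triangle _ (σ t') _).trans (le_of_eq ?_)
      rw [dist_left_rayTo, hσ.dist_eq, Real.dist_eq, abs_of_nonneg (by linarith)]
    have a3 : dist (σ T) x - dist (σ T) w ≤ d := by
      have := dist_triangle (σ T) w x
      rw [dist_comm w x] at this
      linarith
    have b1 : 0 ≤ dist (σ T) x := dist_nonneg
    have b2 : 0 ≤ dist (σ T) w := dist_nonneg
    have c1 : (dist (σ T) x - dist (σ T) w) * (dist (σ T) x + dist (σ T) w) ≤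
        d * (2 * T - t - t' + 2 * S) := by
      refine (mul_le_mul_of_nonneg_right a3 (by linarith)).trans ?_
      exact mul_le_mul_of_nonneg_left (by linarith) hd
    refine le_trans (le_of_eq ?_) c1
    have : (dist (σ T) x - dist (σ T) w) * (dist (σ T) x + dist (σ T) w) =
      dist (σ T) x ^ 2 - dist (σ T) w ^ 2 := by ring
    rw [this, e1, e2]
    ring
  by_contra hcon
  push Not at hcon
  -- `key T` says `2 * T * (t' - t - d) + K ≤ 0`, which fails for large `T` if `d < t' - t`.
  set K := (t' - t) * (- t - t' + 2 * m * S) - d * (- t - t' + 2 * S)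
  have hpos : 0 < t' - t - d := by linarith
  have h1 := key (max t' ((1 - K) / (2 * (t' - t - d)))) (le_max_left _ _)
  have h2 := le_max_right t' ((1 - K) / (2 * (t' - t - d)))
  rw [div_le_iff₀ (by linarith)] at h2
  have hK : K = (t' - t) * (- t - t' + 2 * m * S) - d * (- t - t' + 2 * S) := rfl
  nlinarith

theorem SectorBound.isometry_parallel {σ : ℝ → X} (hσ : Isometry σ) {ρ : Ray X} {m : ℝ}
    (h : SectorBound σ ρ m) (S : ℝ≥0) : Isometry fun t => rayTo (σ t) ρ.endpoint S := by
  have key : ∀ t t' : ℝ, t ≤ t' →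
      dist (rayTo (σ t) ρ.endpoint S) (rayTo (σ t') ρ.endpoint S) = t' - t := by
    intro t t' htt
    refine le_antisymm ?_ (h.le_dist hσ htt S)
    have := h.dist_sq_le hσ t t' S S
    rw [sub_self] at this
    exact abs_le_of_sq_le_sq' (by linarith) (by linarith) |>.2
  refine Isometry.of_dist_eq fun t t' => ?_
  rcases le_total t t' with htt | htt
  · rw [key t t' htt, Real.dist_eq, abs_sub_comm, abs_of_nonneg (by linarith)]
  · rw [dist_comm, key t' t htt, Real.dist_eq, abs_of_nonneg (by linarith)]

/-- The parallel curve at time `S` is itself a line and forms a sector with the remainder of `ρ`, so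
the upper bound is again an equality. -/
theorem SectorBound.dist_sq_eq_of_zero {σ : ℝ → X} (hσ : Isometry σ) {ρ : Ray X} {m : ℝ}
    (h : SectorBound σ ρ m) (u : ℝ) (S S' : ℝ≥0) :
    dist (rayTo (σ u) ρ.endpoint S) (ρ (S + S')) ^ 2 = u ^ 2 + S' ^ 2 + 2 * m * u * S' := by
  have hρ : ρ = rayTo (σ 0) ρ.endpoint := eq_rayTo h.zero rfl
  refine SectorBound.eq (ρ := ρ.shift S) (h.isometry_parallel hσ S) (fun u S' => ?_) u S'
  change dist _ (ρ (S + S')) ^ 2 ≤ _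
  have := h.dist_sq_le hσ u 0 S (S + S')
  rw [← hρ] at this
  refine this.trans (le_of_eq ?_)
  push_cast
  ring

theorem SectorBound.dist_sq_eq {σ : ℝ → X} (hσ : Isometry σ) {ρ : Ray X} {m : ℝ}
    (h : SectorBound σ ρ m) (t t' : ℝ) (S S' : ℝ≥0) :
    dist (rayTo (σ t) ρ.endpoint S) (rayTo (σ t') ρ.endpoint S') ^ 2 =
      (t' - t) ^ 2 + ((S : ℝ) - S') ^ 2 + 2 * m * (t' - t) * (S - S') := by
  wlog hS : S ≤ S' generalizing S S' t t'
  · rw [dist_comm, this t' t S' S (le_of_not_ge hS)]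
    ring
  · have := (h.move hσ t').dist_sq_eq_of_zero (isometry_shift hσ t') (t - t') S (S' - S)
    rw [add_sub_cancel, rayTo_endpoint, add_tsub_cancel_of_le hS, NNReal.coe_sub hS] at this
    rw [this]
    ring

theorem withLp_prod_dist_sq {α β : Type*} [PseudoMetricSpace α] [PseudoMetricSpace β]
    (x y : WithLp 2 (α × β)) :
    dist x y ^ 2 = dist x.fst y.fst ^ 2 + dist x.snd y.snd ^ 2 := by
  rw [WithLp.prod_dist_eq_add (by norm_num)]
  simp only [ENNReal.toReal_ofNat, Real.rpow_ofNat]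
  rw [← Real.sqrt_eq_rpow, Real.sq_sqrt (by positivity)]

theorem SectorBound.boundsFlatHalfPlane {σ : ℝ → X} (hσ : Isometry σ) {ρ : Ray X} {m : ℝ}
    (h : SectorBound σ ρ m) (hm : |m| < 1) : BoundsFlatHalfPlane σ := by
  have hm2 : 0 < 1 - m ^ 2 := by
    have := (sq_lt_one_iff_abs_lt_one m).2 hm
    linarith
  set κ : ℝ≥0 := ⟨√(1 - m ^ 2), Real.sqrt_nonneg _⟩ with hκ
  have hκ0 : (0 : ℝ) < κ := Real.sqrt_pos.2 hm2
  have hκ2 : (κ : ℝ) ^ 2 = 1 - m ^ 2 := Real.sq_sqrt hm2.le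
  -- The rays have horizontal component `-m` and vertical component `κ`: height `p.fst` takes time
  -- `p.fst / κ`, and the base point on `σ` is shifted to compensate the horizontal drift.
  refine ⟨fun p => rayTo (σ (p.snd + m * (p.fst / κ : ℝ≥0))) ρ.endpoint (p.fst / κ),
    Isometry.of_dist_eq fun p q => ?_, fun t => by simp⟩
  have e := h.dist_sq_eq hσ (p.snd + m * (p.fst / κ : ℝ≥0)) (q.snd + m * (q.fst / κ : ℝ≥0))
    (p.fst / κ) (q.fst / κ)
  rw [← sq_eq_sq₀ dist_nonneg dist_nonneg, withLp_prod_dist_sq, e]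
  rw [NNReal.dist_eq, Real.dist_eq, sq_abs, sq_abs]
  push_cast
  have : ((p.fst : ℝ) - q.fst) ^ 2 = (1 - m ^ 2) * ((p.fst : ℝ) / κ - q.fst / κ) ^ 2 := by
    rw [← hκ2]
    field_simp
  rw [this]
  ring

end HalfPlane

/-! ### Asymptotic slope of a convex Lipschitz function. -/

section Convex

/-- By convexity, increments over a fixed nonnegative length are monotone in the starting point, so
they converge at `-∞`. The limit is additive and 1-Lipschitz in the length, hence linear. -/
theorem exists_slope_atBot {B : ℝ → ℝ} (hlip : ∀ u v, |B u - B v| ≤ |u - v|)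
    (hconv : ∀ u v, ∀ s ∈ Icc (0 : ℝ) 1, B ((1 - s) * u + s * v) ≤ (1 - s) * B u + s * B v) :
    ∃ m : ℝ, |m| ≤ 1 ∧ (∀ u, Tendsto (fun x => B (x + u) - B x) atBot (𝓝 (m * u))) ∧
      ∀ x u, 0 ≤ u → m * u ≤ B (x + u) - B x := by
  have hmono : ∀ u, 0 ≤ u → Monotone fun x => B (x + u) - B x := by
    intro u hu x y hxy
    change B (x + u) - B x ≤ B (y + u) - B y
    rcases hu.eq_or_lt with rfl | hu
    · simp
    have hw : 0 < y + u - x := by linarith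
    have hs : u / (y + u - x) ∈ Icc (0 : ℝ) 1 := div_mem_unit hu.le (by linarith)
    have h1 := hconv x (y + u) _ hs
    have h2 := hconv x (y + u) _ (one_sub_mem_unit hs)
    have e1 : (1 - u / (y + u - x)) * x + u / (y + u - x) * (y + u) = x + u := by
      field_simp; ring
    have e2 : (1 - (1 - u / (y + u - x))) * x + (1 - u / (y + u - x)) * (y + u) = y := by
      field_simp; ring
    rw [e1] at h1
    rw [e2] at h2
    linarith
  have hbd : ∀ u, BddBelow (range fun x => B (x + u) - B x) := fun u => ⟨-|u|, by
    rintro _ ⟨x, rfl⟩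
    have := hlip (x + u) x
    rw [add_sub_cancel_left] at this
    exact (abs_le.1 this).1⟩
  have hlim0 : ∀ u, 0 ≤ u → Tendsto (fun x => B (x + u) - B x) atBot
      (𝓝 (⨅ x, (B (x + u) - B x))) := fun u hu => tendsto_atBot_ciInf (hmono u hu) (hbd u)
  have hlim : ∀ u, ∃ L, Tendsto (fun x => B (x + u) - B x) atBot (𝓝 L) := by
    intro u
    rcases le_total 0 u with hu | hu
    · exact ⟨_, hlim0 u hu⟩
    · have h1 := (hlim0 (-u) (by linarith)).comp (tendsto_atBot_add_const_right atBot u tendsto_id)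
      refine ⟨_, h1.neg.congr fun x => ?_⟩
      simp
  choose L hL using hlim
  have hadd : ∀ u v, L (u + v) = L u + L v := by
    intro u v
    refine tendsto_nhds_unique (hL (u + v)) ?_
    refine (((hL u).comp (tendsto_atBot_add_const_right atBot v tendsto_id)).add (hL v)).congr
      fun x => ?_
    simp only [Function.comp, id]
    rw [show x + v + u = x + (u + v) by ring]
    ring
  have hLlip : ∀ u, |L u| ≤ |u| := by
    intro u
    refine le_of_tendsto (hL u).abs (Eventually.of_forall fun x => ?_)
    have := hlip (x + u) x
    rwa [add_sub_cancel_left] at this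
  let Lh : ℝ →+ ℝ := AddMonoidHom.mk' L hadd
  have hcont : Continuous Lh := by
    refine LipschitzWith.continuous (K := 1) (LipschitzWith.of_dist_le_mul fun u v => ?_)
    rw [Real.dist_eq, Real.dist_eq, ← map_sub, NNReal.coe_one, one_mul]
    exact hLlip _
  have hlin : ∀ u, L u = L 1 * u := by
    intro u
    have := map_real_smul Lh hcont u 1
    simp only [smul_eq_mul, mul_one] at this
    change L u = u * L 1 at this
    rw [this, mul_comm]
  refine ⟨L 1, by simpa using hLlip 1, fun u => by rw [← hlin]; exact hL u, fun x u hu => ?_⟩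
  rw [← hlin, tendsto_nhds_unique (hL u) (hlim0 u hu)]
  exact ciInf_le (hbd u) x

end Convex

/-! ### Axes of rank one isometries and their fixed points at infinity. -/

section Lines

variable {X : Type u} [MetricSpace X]

/-- The positive half of a geodesic line. -/
def lineRay {σ : ℝ → X} (hσ : Isometry σ) : Ray X :=
  ⟨fun t => σ t, Isometry.of_dist_eq fun s t => by rw [hσ.dist_eq, NNReal.dist_eq, Real.dist_eq]⟩

theorem isometry_reverse {σ : ℝ → X} (hσ : Isometry σ) : Isometry fun t => σ (-t) :=
  hσ.comp (IsometryEquiv.neg ℝ).isometry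

theorem BoundsFlatHalfPlane.of_reverse {σ : ℝ → X}
    (h : BoundsFlatHalfPlane fun t => σ (-t)) : BoundsFlatHalfPlane σ := by
  obtain ⟨ι, hι, h0⟩ := h
  refine ⟨fun p => ι (WithLp.toLp 2 (p.fst, -p.snd)), Isometry.of_dist_eq fun p q => ?_,
    fun t => ?_⟩
  · rw [hι.dist_eq, ← sq_eq_sq₀ dist_nonneg dist_nonneg, withLp_prod_dist_sq, withLp_prod_dist_sq]
    simp [dist_neg_neg]
  · change ι (WithLp.toLp 2 (0, -t)) = σ t
    rw [h0]
    change σ (- -t) = σ t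
    rw [neg_neg]

theorem BoundsFlatHalfPlane.map {σ : ℝ → X} (h : BoundsFlatHalfPlane σ) (f : X ≃ᵢ X) :
    BoundsFlatHalfPlane fun t => f (σ t) := by
  obtain ⟨ι, hι, h0⟩ := h
  exact ⟨f ∘ ι, f.isometry.comp hι, fun t => by simp [h0]⟩

/-- `h` translates by `l > 0` the geodesic line `σ`, which does not bound a flat half-plane. -/
structure IsRankOneAxis (h : X ≃ᵢ X) (σ : ℝ → X) (l : ℝ) : Prop where
  pos : 0 < l
  isometry : Isometry σ
  translates : ∀ t, h (σ t) = σ (t + l)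
  notFlat : ¬ BoundsFlatHalfPlane σ

namespace IsRankOneAxis

variable {h : X ≃ᵢ X} {σ : ℝ → X} {l : ℝ}

theorem inv (A : IsRankOneAxis h σ l) : IsRankOneAxis h⁻¹ (fun t => σ (-t)) l where
  pos := A.pos
  isometry := isometry_reverse A.isometry
  translates t := by
    change h.symm (σ (-t)) = _
    rw [h.symm_apply_eq, A.translates]
    congr 1
    ring
  notFlat H := A.notFlat H.of_reverse

theorem pow_apply (A : IsRankOneAxis h σ l) (n : ℕ) (t : ℝ) : (h ^ n) (σ t) = σ (t + n * l) := by
  induction n generalizing t with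
  | zero => simp
  | succ n ih =>
    rw [pow_succ]
    change (h ^ n) (h (σ t)) = _
    rw [A.translates, ih]
    congr 1
    push_cast
    ring

theorem pow (A : IsRankOneAxis h σ l) {n : ℕ} (hn : 0 < n) : IsRankOneAxis (h ^ n) σ (n * l) where
  pos := mul_pos (Nat.cast_pos.2 hn) A.pos
  isometry := A.isometry
  translates t := A.pow_apply n t
  notFlat := A.notFlat

theorem conj (A : IsRankOneAxis h σ l) (f : X ≃ᵢ X) :
    IsRankOneAxis (f * h * f⁻¹) (fun t => f (σ t)) l where
  pos := A.pos
  isometry := f.isometry.comp A.isometry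
  translates t := by
    change f (h (f.symm (f (σ t)))) = _
    rw [f.symm_apply_apply, A.translates]
  notFlat H := A.notFlat (by
    have := H.map f.symm
    simpa using this)

/-- The attracting fixed point. -/
def attr (A : IsRankOneAxis h σ l) : Boundary X := (lineRay A.isometry).endpoint

/-- The repelling fixed point. -/
def rep (A : IsRankOneAxis h σ l) : Boundary X := A.inv.attr

theorem rep_inv (A : IsRankOneAxis h σ l) : A.inv.rep = A.attr := by
  change Ray.endpoint _ = Ray.endpoint _
  congr 1
  ext t
  change σ (- -t) = σ t
  rw [neg_neg]

theorem pow_inv_apply (A : IsRankOneAxis h σ l) (n : ℕ) (t : ℝ) :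
    (h ^ n).symm (σ t) = σ (t - n * l) := by
  rw [IsometryEquiv.symm_apply_eq, A.pow_apply, sub_add_cancel]

variable [IsCNSpace X] [ProperSpace X]

theorem rayTo_attr (A : IsRankOneAxis h σ l) : rayTo (σ 0) A.attr = lineRay A.isometry :=
  (eq_rayTo (congrArg σ NNReal.coe_zero) rfl).symm

end IsRankOneAxis

end Lines

/-! ### North-south dynamics of rank one isometries. -/

section Dynamics

variable {X : Type u} [MetricSpace X] [IsCNSpace X]

theorem seg_def (x y : X) (t : ℝ) : seg x y t = geo x y (t / dist x y) := rfl

theorem geo_self (p : X) {s : ℝ} (hs : s ∈ Icc (0 : ℝ) 1) : geo p p s = p :=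
  (eq_geo hs (by simp) (by simp)).symm

theorem dist_geo_le (p x y : X) {s : ℝ} (hs : s ∈ Icc (0 : ℝ) 1) :
    dist p (geo x y s) ≤ (1 - s) * dist p x + s * dist p y := by
  have := dist_geo_geo_le p p x y hs
  rwa [geo_self p hs] at this

theorem busemann_line_convex (ρ : Ray X) {σ : ℝ → X} (hσ : Isometry σ) (u v : ℝ) {s : ℝ}
    (hs : s ∈ Icc (0 : ℝ) 1) :
    busemann ρ (σ ((1 - s) * u + s * v)) ≤
      (1 - s) * busemann ρ (σ u) + s * busemann ρ (σ v) := by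
  refine le_of_tendsto_of_tendsto' (tendsto_busemann ρ _)
    (((tendsto_busemann ρ (σ u)).const_mul _).add ((tendsto_busemann ρ (σ v)).const_mul _))
    fun T => ?_
  have := dist_geo_le (ρ T) (σ u) (σ v) hs
  rw [← line_eq_geo hσ u v hs, dist_comm _ (σ u), dist_comm _ (σ v), dist_comm] at this
  linarith

theorem abs_busemann_line_sub_le {X : Type u} [MetricSpace X] (ρ : Ray X) {σ : ℝ → X} (hσ : Isometry σ) (u v : ℝ) :
    |busemann ρ (σ u) - busemann ρ (σ v)| ≤ |u - v| := by
  have h1 := busemann_le_add ρ (σ u) (σ v)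
  have h2 := busemann_le_add ρ (σ v) (σ u)
  rw [hσ.dist_eq, Real.dist_eq] at h1 h2
  rw [abs_sub_comm v] at h2
  exact abs_sub_le_iff.2 ⟨by linarith, by linarith⟩

theorem dist_seg_sq_le_of_dist_le {o y z : X} (hz : dist z y ≤ dist o y) {S : ℝ} (h0 : 0 ≤ S)
    (hS : S ≤ dist o y) : dist z (seg o y S) ^ 2 ≤ S ^ 2 + dist z o ^ 2 := by
  have h1 := dist_seg_sq_sub_le z o y h0 hS
  have hu := div_mem_unit h0 hS
  have h2 : dist z y ^ 2 ≤ dist o y ^ 2 := pow_le_pow_left₀ dist_nonneg hz 2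
  have h3 := mul_nonneg hu.1 (sub_nonneg.2 h2)
  have h4 := mul_nonneg hu.1 (sq_nonneg (dist z o))
  nlinarith

theorem seg_line {σ : ℝ → X} (hσ : Isometry σ) {a t : ℝ} (ht : 0 ≤ t) (hta : t ≤ a) :
    seg (σ 0) (σ a) t = σ t := by
  have h1 : dist (σ 0) (σ t) = t := by
    rw [hσ.dist_eq, Real.dist_eq, zero_sub, abs_neg, abs_of_nonneg ht]
  have := eq_seg (x := σ 0) (y := σ a) (m := σ t) (by
    rw [h1, hσ.dist_eq, hσ.dist_eq, Real.dist_eq, Real.dist_eq, abs_sub_comm,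
      abs_of_nonneg (by linarith), zero_sub, abs_neg, abs_of_nonneg (by linarith)]
    linarith)
  rw [h1] at this
  exact this.symm

/-- The geodesic segment between `p` and `y`, as a set. -/
def segSet {X : Type u} [MetricSpace X] (p y : X) : Set X := {z | dist p z + dist z y ≤ dist p y}

theorem mem_segSet {X : Type u} [MetricSpace X] {p y z : X} :
    z ∈ segSet p y ↔ dist p z + dist z y ≤ dist p y := Iff.rfl

theorem geo_mem_segSet (p y : X) {s : ℝ} (hs : s ∈ Icc (0 : ℝ) 1) : geo p y s ∈ segSet p y := by
  rw [mem_segSet, dist_left_geo _ _ hs, dist_geo_right _ _ hs]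
  linarith

/-- At the nearest point `z` the segment makes a right or obtuse angle with the direction to `o`;
metrically, the Bruhat-Tits inequality is applied at ratio `s` from `z` to `y`, and `s` tends to 0.
-/
theorem dist_le_of_infDist_segSet_eq {o p y z : X} (hz : z ∈ segSet p y)
    (hd : Metric.infDist o (segSet p y) = dist o z) : dist z y ≤ dist o y := by
  have key : ∀ s : ℝ, 0 < s → s ≤ 1 → (1 - s) * dist z y ^ 2 ≤ dist o y ^ 2 := by
    intro s hs hs1
    have hs' : s ∈ Icc (0 : ℝ) 1 := ⟨hs.le, hs1⟩
    have hmem : geo z y s ∈ segSet p y := by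
      have h1 : dist p z + dist z y ≤ dist p y := hz
      have h2 := dist_left_geo z y hs'
      have h3 := dist_geo_right z y hs'
      have h4 := dist_triangle p z (geo z y s)
      rw [mem_segSet]
      linarith
    have h1 := Metric.infDist_le_dist_of_mem (x := o) hmem
    rw [hd] at h1
    have h2 := pow_le_pow_left₀ dist_nonneg h1 2
    have h3 := dist_geo_sq_le o z y hs'
    have h4 : s * ((1 - s) * dist z y ^ 2) ≤ s * dist o y ^ 2 := by
      nlinarith [sq_nonneg (dist o z)]
    exact le_of_mul_le_mul_left h4 hs
  refine abs_le_of_sq_le_sq' ?_ dist_nonneg |>.2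
  have h1 : Tendsto (fun s : ℝ => (1 - s) * dist z y ^ 2) (𝓝[>] 0)
      (𝓝 ((1 - 0) * dist z y ^ 2)) :=
    Tendsto.mono_left (Continuous.tendsto (by fun_prop) 0) nhdsWithin_le_nhds
  rw [sub_zero, one_mul] at h1
  refine le_of_tendsto h1 ?_
  filter_upwards [Ioo_mem_nhdsGT (zero_lt_one' ℝ)] with s hs
  exact key s hs.1 hs.2.le

variable [ProperSpace X] {h : X ≃ᵢ X} {σ : ℝ → X} {l : ℝ}

/-- The orbit of a boundary point different from the repelling fixed point accumulates at the
attracting fixed point. -/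
theorem IsRankOneAxis.exists_pow_near (A : IsRankOneAxis h σ l) {η : Boundary X}
    (hη : η ≠ A.rep) (R : ℝ≥0) {ε : ℝ} (hε : 0 < ε) :
    ∃ j : ℕ, dist (rayTo (σ 0) (Boundary.map (h ^ j) η) R) (σ R) < ε := by
  have hσ := A.isometry
  set ρ := rayTo (σ 0) η with hρ
  have hρη : ρ.endpoint = η := by simp [hρ]
  obtain ⟨m, hm1, hlim, hslope⟩ := exists_slope_atBot (B := fun t => busemann ρ (σ t))
    (abs_busemann_line_sub_le ρ hσ) (fun u v s hs => busemann_line_convex ρ hσ u v hs)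
  obtain ⟨ρ', h0, hρ'⟩ := exists_ray_tendsto (hyperfilter ℕ)
    (fun j t => rayTo (σ 0) (Boundary.map (h ^ j) η) t) (σ 0) (fun n => by simp)
    (fun s t => Eventually.of_forall fun n => by rw [Ray.dist_eq, NNReal.dist_eq])
  -- `h ^ j` carries `σ (-j * l)` to `σ 0`, so the rays converging to `ρ'` are translates of rays to
  -- `η` issuing far down the axis, where Busemann increments approach `m * u`.
  have hsect : SectorBound σ ρ' m := by
    intro u S
    have hx : Tendsto (fun j : ℕ => (0 : ℝ) - j * l) atTop atBot := by
      have := (tendsto_natCast_atTop_atTop (R := ℝ)).atTop_mul_const A.pos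
      simpa using this
    have h1 : Tendsto (fun j : ℕ => u ^ 2 + (S : ℝ) ^ 2 + 2 * S *
        (busemann ρ (σ (0 - j * l + u)) - busemann ρ (σ (0 - j * l)))) (hyperfilter ℕ)
        (𝓝 (u ^ 2 + (S : ℝ) ^ 2 + 2 * S * (m * u))) :=
      ((((hlim u).comp hx).mono_left Nat.hyperfilter_le_atTop).const_mul _).const_add _
    have h2 := ((tendsto_const_nhds (x := σ u)).dist (hρ' S)).pow 2
    refine (le_of_tendsto_of_tendsto' h2 h1 fun j => ?_).trans (le_of_eq (by ring))
    have h3 := dist_rayTo_sq_le ρ (σ (0 - j * l + u)) (σ (0 - j * l)) S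
    rw [hρη, hσ.dist_eq, Real.dist_eq, sq_abs, add_sub_cancel_left] at h3
    rwa [← (h ^ j).isometry.dist_eq (σ (0 - j * l + u)), map_rayTo, A.pow_apply, A.pow_apply,
      sub_add_cancel, show 0 - j * l + u + j * l = u by ring] at h3
  rcases lt_or_eq_of_le hm1 with hm | hm
  · exact absurd (hsect.boundsFlatHalfPlane hσ hm) A.notFlat
  -- For `m = 1` the Busemann function of `η` drops at full speed along the negative half of the
  -- axis, which is then the ray to `η`. For `m = -1` the sector bound collapses `ρ'` to the
  -- positive half.
  rcases (abs_eq zero_le_one).1 hm with rfl | rfl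
  · exfalso
    apply hη
    have : rayTo (σ 0) η = lineRay A.inv.isometry := by
      ext S
      have h1 := dist_rayTo_sq_le ρ (σ (-S)) (σ 0) S
      have h2 := hslope (-S) S S.coe_nonneg
      rw [hρη, hσ.dist_eq, Real.dist_eq, sq_abs] at h1
      simp only [neg_add_cancel] at h2
      have h3 := mul_le_mul_of_nonneg_left h2 S.coe_nonneg
      have h4 : dist (σ (-S)) (rayTo (σ 0) η S) ^ 2 ≤ 0 := by nlinarith
      rw [dist_comm] at h4
      exact dist_eq_zero.1 (pow_eq_zero_iff two_ne_zero |>.1 (le_antisymm h4 (sq_nonneg _)))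
    rw [← rayTo_endpoint (σ 0) η, this]
    rfl
  · have h1 : ρ' R = σ R := by
      have := hsect R R
      have h4 : dist (σ R) (ρ' R) ^ 2 ≤ 0 := by nlinarith
      rw [dist_comm] at h4
      exact dist_eq_zero.1 (pow_eq_zero_iff two_ne_zero |>.1 (le_antisymm h4 (sq_nonneg _)))
    have h2 := hρ' R
    rw [h1] at h2
    exact (h2.eventually (Metric.ball_mem_nhds _ hε)).exists

/-- `h ^ d` is rank one with the same axis, so the constant orbit of `η` under it accumulates at the
attracting point. -/
theorem IsRankOneAxis.eq_attr_of_map_pow_eq (A : IsRankOneAxis h σ l) {η : Boundary X}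
    (hη : η ≠ A.rep) {d : ℕ} (hd : 0 < d) (hfix : Boundary.map (h ^ d) η = η) : η = A.attr := by
  have hfixj : ∀ j : ℕ, Boundary.map ((h ^ d) ^ j) η = η := by
    intro j
    induction j with
    | zero => rw [pow_zero, Boundary.map_one]
    | succ j ih => rw [pow_succ, Boundary.map_mul, hfix, ih]
  have : rayTo (σ 0) η = lineRay A.isometry := by
    ext R
    refine eq_of_forall_dist_le fun ε hε => ?_
    obtain ⟨j, hj⟩ := (A.pow hd).exists_pow_near (show η ≠ (A.pow hd).rep from hη) R hε
    rw [hfixj] at hj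
    exact hj.le
  rw [← rayTo_endpoint (σ 0) η, this]
  rfl

theorem isCompact_segSet {X : Type u} [MetricSpace X] [ProperSpace X] (p y : X) :
    IsCompact (segSet p y) := by
  refine (isCompact_closedBall p (dist p y)).of_isClosed_subset
    (isClosed_le (by fun_prop) (by fun_prop)) fun z hz => ?_
  have h1 : dist p z + dist z y ≤ dist p y := hz
  rw [Metric.mem_closedBall, dist_comm]
  linarith [dist_nonneg (x := z) (y := y)]

theorem left_mem_segSet {X : Type u} [MetricSpace X] (p y : X) : p ∈ segSet p y := by
  simp [segSet]

theorem segSet_comm {X : Type u} [MetricSpace X] (p y : X) : segSet p y = segSet y p := by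
  ext z
  rw [mem_segSet, mem_segSet, dist_comm p z, dist_comm z y, dist_comm p y, add_comm]

theorem map_mem_segSet {X : Type u} [MetricSpace X] (f : X ≃ᵢ X) {p y z : X}
    (hz : z ∈ segSet p y) : f z ∈ segSet (f p) (f y) := by
  simpa only [mem_segSet, f.isometry.dist_eq] using hz

theorem infDist_segSet_le (o p y y' : X) :
    Metric.infDist o (segSet p y') ≤ Metric.infDist o (segSet p y) + dist y y' := by
  obtain ⟨z, hz, hd⟩ := (isCompact_segSet p y).exists_infDist_eq_dist ⟨p, left_mem_segSet p y⟩ o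
  have hz' : dist p z + dist z y ≤ dist p y := hz
  have hu : dist p z / dist p y ∈ Icc (0 : ℝ) 1 :=
    div_mem_unit dist_nonneg (by linarith [dist_nonneg (x := z) (y := y)])
  have ez : z = geo p y (dist p z / dist p y) := eq_seg hz'
  have h1 := Metric.infDist_le_dist_of_mem (x := o) (geo_mem_segSet p y' hu)
  have h2 := dist_geo_geo_left_le p y y' hu
  rw [← ez] at h2
  have h3 := dist_triangle o z (geo p y' (dist p z / dist p y))
  have h4 : dist p z / dist p y * dist y y' ≤ dist y y' :=
    mul_le_of_le_one_left dist_nonneg hu.2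
  rw [hd]
  linarith

/-- Intermediate values: `y` slides back along its geodesic from `σ 0` until the distance is exactly
`r`. At time `N` the distance is at most 1, since `σ 0` lies on the segment from `σ (-n)` to `σ N`.
-/
theorem exists_infDist_segSet_eq (hσ : Isometry σ) {r : ℝ} (hr : 1 < r) {N : ℝ≥0} {n : ℝ}
    (hn : 0 ≤ n) {y : X} (hy : N < dist (σ 0) y) (hyN : dist (seg (σ 0) y N) (σ N) < 1)
    (hfar : r < Metric.infDist (σ 0) (segSet (σ (-n)) y)) :
    ∃ y' : X, N ≤ dist (σ 0) y' ∧ dist (seg (σ 0) y' N) (σ N) < 1 ∧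
      Metric.infDist (σ 0) (segSet (σ (-n)) y') = r := by
  set φ : ℝ → ℝ := fun s => Metric.infDist (σ 0) (segSet (σ (-n)) (seg (σ 0) y s)) with hφ
  have hcont : ContinuousOn φ (Icc (N : ℝ) (dist (σ 0) y)) := by
    refine LipschitzOnWith.continuousOn (K := 1) (LipschitzOnWith.of_le_add fun s hs t ht => ?_)
    have h1 := infDist_segSet_le (σ 0) (σ (-n)) (seg (σ 0) y t) (seg (σ 0) y s)
    have h2 := dist_seg_seg (x := σ 0) (y := y) ⟨N.coe_nonneg.trans ht.1, ht.2⟩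
      ⟨N.coe_nonneg.trans hs.1, hs.2⟩
    rw [h2, abs_sub_comm, ← Real.dist_eq] at h1
    exact h1
  have hN : φ N ≤ r := by
    have h1 := infDist_segSet_le (σ 0) (σ (-n)) (σ N) (seg (σ 0) y N)
    have h2 : σ 0 ∈ segSet (σ (-n)) (σ N) := by
      rw [mem_segSet, hσ.dist_eq, hσ.dist_eq, hσ.dist_eq, Real.dist_eq, Real.dist_eq, Real.dist_eq]
      rw [abs_of_nonpos (by linarith), abs_of_nonpos (by linarith [N.coe_nonneg]),
        abs_of_nonpos (by linarith [N.coe_nonneg])]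
      linarith
    rw [Metric.infDist_zero_of_mem h2, dist_comm] at h1
    change Metric.infDist _ _ ≤ _
    linarith
  have hD : r ≤ φ (dist (σ 0) y) := by
    change r ≤ Metric.infDist _ (segSet _ (seg (σ 0) y (dist (σ 0) y)))
    rw [seg_dist]
    exact hfar.le
  obtain ⟨s, hs, hsr⟩ := intermediate_value_Icc hy.le hcont ⟨hN, hD⟩
  refine ⟨seg (σ 0) y s, ?_, ?_, hsr⟩
  · rw [dist_left_seg (N.coe_nonneg.trans hs.1) hs.2]
    exact hs.1
  · rwa [seg_seg N.coe_nonneg hs.1 hs.2]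

/-- If geodesics joining points near the two ends of the line `σ` stay away from `σ 0`, then there
are points which are far from `σ` and see `σ` as in a flat half-plane. -/
theorem exists_point_of_far (hσ : Isometry σ) {r : ℝ} (hr : 1 < r)
    (hfar : ∀ N : ℝ≥0, ∃ n : ℝ, N ≤ n ∧ ∃ y : X, N < dist (σ 0) y ∧
      dist (seg (σ 0) y N) (σ N) < 1 ∧ r < Metric.infDist (σ 0) (segSet (σ (-n)) y)) :
    ∃ z : X, dist (σ 0) z = r ∧ ∀ u, dist z (σ u) ^ 2 ≤ u ^ 2 + r ^ 2 := by
  -- `z` is the point of the segment nearest to `σ 0`; it is no farther than `σ 0` from either end,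
  -- and this survives in the limit as orthogonality to both halves of `σ`.
  have hex : ∀ N : ℕ, ∃ n : ℝ, N ≤ n ∧ ∃ y z : X, N ≤ dist (σ 0) y ∧
      dist (seg (σ 0) y N) (σ N) < 1 ∧ dist z y ≤ dist (σ 0) y ∧
      dist z (σ (-n)) ≤ dist (σ 0) (σ (-n)) ∧ dist (σ 0) z = r := by
    intro N
    obtain ⟨n, hn, y, h1, h2, h3⟩ := hfar N
    obtain ⟨y', k1, k2, k3⟩ := exists_infDist_segSet_eq hσ hr (N.cast_nonneg.trans hn) h1 h2 h3
    obtain ⟨z, hz, hd⟩ := (isCompact_segSet (σ (-n)) y').exists_infDist_eq_dist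
      ⟨_, left_mem_segSet _ _⟩ (σ 0)
    refine ⟨n, hn, y', z, k1, k2, dist_le_of_infDist_segSet_eq hz hd, ?_, by rw [← hd, k3]⟩
    rw [segSet_comm] at hz hd
    exact dist_le_of_infDist_segSet_eq hz hd
  choose n hn y z hy hyN hzy hzn hzr using hex
  obtain ⟨w, -, hw⟩ := (isCompact_closedBall (σ 0) r).ultrafilter_le_nhds
    ((hyperfilter ℕ).map z) (le_principal_iff.2 (Eventually.of_forall fun N => by
      rw [Metric.mem_closedBall, dist_comm, hzr] : ∀ᶠ N in _, z N ∈ Metric.closedBall (σ 0) r))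
  have hw' : Tendsto z (hyperfilter ℕ) (𝓝 w) := hw
  refine ⟨w, tendsto_nhds_unique (tendsto_const_nhds.dist hw') (by simp [hzr]), fun u => ?_⟩
  rcases le_total 0 u with hu | hu
  · have hlim : Tendsto (fun N => seg (σ 0) (y N) u) (hyperfilter ℕ) (𝓝 (σ u)) := by
      rw [tendsto_iff_dist_tendsto_zero]
      refine squeeze_zero' (Eventually.of_forall fun _ => dist_nonneg) ?_
        (((tendsto_const_div_atTop_nhds_zero_nat u)).mono_left Nat.hyperfilter_le_atTop)
      refine Nat.hyperfilter_le_atTop ?_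
      obtain ⟨M, hM⟩ := exists_nat_ge u
      filter_upwards [eventually_ge_atTop M] with N hN
      have huN : u ≤ N := hM.trans (by exact_mod_cast hN)
      have e1 : seg (σ 0) (seg (σ 0) (y N) N) u = seg (σ 0) (y N) u := seg_seg hu huN (hy N)
      have e2 : seg (σ 0) (σ N) u = σ u := seg_line hσ hu huN
      have d1 : dist (σ 0) (seg (σ 0) (y N) N) = N := dist_left_seg N.cast_nonneg (hy N)
      have d2 : dist (σ 0) (σ N) = N := by
        rw [hσ.dist_eq, Real.dist_eq, zero_sub, abs_neg, abs_of_nonneg N.cast_nonneg]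
      rw [← e1, ← e2, seg_def _ (seg _ _ _), seg_def _ (σ N), d1, d2]
      refine (dist_geo_geo_left_le _ _ _ (div_mem_unit hu huN)).trans ?_
      exact mul_le_of_le_one_right (div_mem_unit hu huN).1 (hyN N).le
    refine le_of_tendsto ((hw'.dist hlim).pow 2) (Nat.hyperfilter_le_atTop ?_)
    obtain ⟨M, hM⟩ := exists_nat_ge u
    filter_upwards [eventually_ge_atTop M] with N hN
    have huN : u ≤ N := hM.trans (by exact_mod_cast hN)
    have := dist_seg_sq_le_of_dist_le (hzy N) hu (huN.trans (hy N))
    rwa [dist_comm _ (σ 0), hzr] at this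
  · refine le_of_tendsto ((hw'.dist tendsto_const_nhds).pow 2) (Nat.hyperfilter_le_atTop ?_)
    obtain ⟨M, hM⟩ := exists_nat_ge (-u)
    filter_upwards [eventually_ge_atTop M] with N hN
    have huN : -u ≤ n N := hM.trans ((by exact_mod_cast hN : (M : ℝ) ≤ N).trans (hn N))
    have e := seg_line (isometry_reverse hσ) (neg_nonneg.2 hu) huN
    simp only [neg_neg, neg_zero] at e
    have := dist_seg_sq_le_of_dist_le (hzn N) (neg_nonneg.2 hu) (by
      rw [hσ.dist_eq, Real.dist_eq]
      exact huN.trans ((le_abs_self _).trans (by simp)))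
    rwa [dist_comm _ (σ 0), hzr, e, neg_sq] at this

/-- Geodesics joining points near the two ends of a line which does not bound a flat half-plane pass
near the line. -/
theorem exists_infDist_segSet_le (hσ : Isometry σ) (hflat : ¬ BoundsFlatHalfPlane σ) :
    ∃ (r : ℝ) (N : ℝ≥0), ∀ n : ℝ, N ≤ n → ∀ y : X, N < dist (σ 0) y →
      dist (seg (σ 0) y N) (σ N) < 1 → Metric.infDist (σ 0) (segSet (σ (-n)) y) ≤ r := by
  by_contra hcon
  push Not at hcon
  -- Points at distances `k + 2`, all exceeding 1, see `σ` at a right angle; the limit of the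
  -- segments towards them satisfies the sector bound with `m = 0`.
  have hz : ∀ k : ℕ, ∃ z : X, dist (σ 0) z = (k : ℝ) + 2 ∧
      ∀ u, dist z (σ u) ^ 2 ≤ u ^ 2 + ((k : ℝ) + 2) ^ 2 := fun k =>
    exists_point_of_far hσ (by linarith [k.cast_nonneg (α := ℝ)]) (hcon ((k : ℝ) + 2))
  choose z hz0 hz using hz
  have hd : Tendsto (fun k => dist (σ 0) (z k)) (hyperfilter ℕ) atTop := by
    simp only [hz0]
    exact (tendsto_atTop_add_const_right _ _ tendsto_natCast_atTop_atTop).mono_left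
      Nat.hyperfilter_le_atTop
  obtain ⟨ρ, h0, hρ⟩ := exists_ray_tendsto_seg _ (σ 0) z hd
  refine hflat (SectorBound.boundsFlatHalfPlane (ρ := ρ) (m := 0) hσ (fun u S => ?_) (by simp))
  refine le_of_tendsto ((tendsto_const_nhds.dist (hρ S)).pow 2) ?_
  filter_upwards [hd.eventually_ge_atTop (S : ℝ)] with k hk
  have h1 := dist_seg_sq_sub_le (σ u) (σ 0) (z k) S.coe_nonneg hk
  have hu := div_mem_unit S.coe_nonneg hk
  have h2 := hz k u
  rw [hσ.dist_eq, Real.dist_eq, sub_zero, sq_abs, dist_comm (σ u) (z k)] at h1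
  have h3 := mul_le_mul_of_nonneg_left (show dist (z k) (σ u) ^ 2 - dist (σ 0) (z k) ^ 2 ≤ u ^ 2 by
    rw [hz0]; linarith) hu.1
  linarith

theorem exists_near_of_infDist_le {X : Type u} [MetricSpace X] [ProperSpace X] (o p y : X) {r : ℝ}
    (h : Metric.infDist o (segSet p y) ≤ r) : ∃ b ∈ segSet p y, dist b o ≤ r := by
  obtain ⟨z, hz, hd⟩ := (isCompact_segSet p y).exists_infDist_eq_dist ⟨p, left_mem_segSet p y⟩ o
  exact ⟨z, hz, by rw [dist_comm, ← hd]; exact h⟩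

/-- Geodesics from points far out on the negative part of the axis of `h` to points near a boundary
point different from the repelling fixed point of `h` pass near the base point. -/
theorem IsRankOneAxis.exists_near (A : IsRankOneAxis h σ l) {η : Boundary X} (hη : η ≠ A.rep) :
    ∃ (R : ℝ≥0) (C N : ℝ), 0 ≤ C ∧ ∀ y : X, Compactification.pt y ∈ coneNhd (σ 0) η R 1 →
      ∀ n : ℝ, N ≤ n → ∃ b ∈ segSet (σ (-n)) y, dist b (σ 0) ≤ C := by
  obtain ⟨r, N, hN⟩ := exists_infDist_segSet_le A.isometry A.notFlat
  -- A power of `h` brings `η` near the attracting end, where the bound for the line applies;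
  -- pulling back by `h ^ j` costs `j * l` in the constants.
  obtain ⟨j, hj⟩ := A.exists_pow_near hη N zero_lt_one
  have hmem : Compactification.bd η ∈ coneNhd ((h ^ j).symm (σ 0))
      (Boundary.map (h ^ j).symm A.attr) N 1 := by
    rw [← map_mem_coneNhd_iff (h ^ j), Boundary.map_map_symm, IsometryEquiv.apply_symm_apply,
      mem_coneNhd, A.rayTo_attr]
    exact ⟨trivial, hj⟩
  obtain ⟨R, hR⟩ := exists_coneNhd_subset hmem (σ 0)
  have hjl : 0 ≤ j * l := mul_nonneg j.cast_nonneg A.pos.le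
  refine ⟨R, max r 0 + j * l, N + j * l, add_nonneg (le_max_right _ _) hjl, fun y hy n hn => ?_⟩
  have h1 := hR hy
  rw [← map_mem_coneNhd_iff (h ^ j), Boundary.map_map_symm, IsometryEquiv.apply_symm_apply,
    mem_coneNhd, A.rayTo_attr] at h1
  obtain ⟨b, hb, hbr⟩ := exists_near_of_infDist_le _ _ _
    (hN (n - j * l) (by linarith) ((h ^ j) y) h1.1 h1.2)
  have hb' := map_mem_segSet (h ^ j).symm hb
  rw [A.pow_inv_apply, IsometryEquiv.symm_apply_apply] at hb'
  refine ⟨(h ^ j).symm b, by convert hb' using 2; ring_nf, ?_⟩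
  have h2 := dist_triangle ((h ^ j).symm b) ((h ^ j).symm (σ 0)) (σ 0)
  rw [IsometryEquiv.dist_eq, A.pow_inv_apply, A.isometry.dist_eq, Real.dist_eq, zero_sub, sub_zero,
    abs_neg, abs_of_nonneg hjl] at h2
  linarith [le_max_left r 0]

/-- Uniform contraction towards the attracting fixed point. -/
theorem IsRankOneAxis.exists_nhds_pow_subset (A : IsRankOneAxis h σ l) {ζ : Boundary X}
    (hζ : ζ ≠ A.rep) :
    ∃ V ∈ 𝓝 ζ, ∀ U ∈ 𝓝 A.attr, ∃ J : ℕ, ∀ j ≥ J, ∀ z ∈ V, Boundary.map (h ^ j) z ∈ U := by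
  obtain ⟨R, C, N, hC, hnear⟩ := A.exists_near hζ
  refine ⟨_, mem_nhds_boundary (σ 0) ζ R zero_lt_one, fun U hU => ?_⟩
  obtain ⟨R', hR'⟩ := exists_subset_of_mem_nhds_boundary (σ 0) hU
  -- The image under `h ^ j` of a geodesic from `σ (-j * l)` starts at `σ 0` and passes within `C`
  -- of `σ (j * l)`; `J` makes the resulting deviation `2 * R' * C / (j * l - C)` at time `R'` less
  -- than 1.
  obtain ⟨J, hJ⟩ := exists_nat_ge ((max N (C + R' + 2 * R' * C + 1)) / l)
  refine ⟨J, fun j hj z hz => hR' _ ?_⟩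
  have hjl : max N (C + R' + 2 * R' * C + 1) ≤ j * l := by
    rw [div_le_iff₀ A.pos] at hJ
    refine hJ.trans (mul_le_mul_of_nonneg_right (by exact_mod_cast hj) A.pos.le)
  have hN := (le_max_left _ _).trans hjl
  have hC' := (le_max_right _ _).trans hjl
  have hR0 : (0 : ℝ) ≤ R' := R'.coe_nonneg
  have hRC : 0 ≤ 2 * R' * C := by positivity
  have hpos : 0 < j * l - C := by linarith
  rw [A.rayTo_attr]
  change dist _ (σ R') < 1
  refine lt_of_le_of_lt (b := 2 * R' * C / (j * l - C)) ?_ (by rw [div_lt_one hpos]; linarith)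
  have hlim := (tendsto_seg_ray (σ 0) ((rayTo (σ 0) z).map (h ^ j)) R').dist
    (tendsto_const_nhds (x := σ R'))
  rw [← Boundary.map_endpoint, rayTo_endpoint] at hlim
  refine le_of_tendsto hlim ?_
  filter_upwards [eventually_gt_atTop R] with T hT
  have hy : Compactification.pt (rayTo (σ 0) z T) ∈ coneNhd (σ 0) ζ R 1 := by
    rw [mem_coneNhd]
    refine ⟨?_, ?_⟩
    · change (R : ℝ) < dist _ _
      rw [dist_left_rayTo]
      exact hT
    · change dist (seg _ _ _) _ < 1
      rw [seg_rayTo _ _ hT.le]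
      exact hz
  obtain ⟨b, hb, hbC⟩ := hnear _ hy (j * l) hN
  have hb' := map_mem_segSet (h ^ j) hb
  rw [A.pow_apply, neg_add_cancel] at hb'
  have d0 : dist (σ 0) (σ (j * l)) = j * l := by
    rw [A.isometry.dist_eq, Real.dist_eq, zero_sub, abs_neg, abs_of_nonneg (by linarith)]
  have key := dist_seg_seg_le_of_near (a := σ (j * l)) (D := j * l) (C := C) (t := R') hb' (by
    have := A.pow_apply j 0
    rw [zero_add] at this
    rwa [← this, IsometryEquiv.dist_eq]) d0.ge R'.coe_nonneg (by linarith) hpos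
  rwa [seg_line A.isometry R'.coe_nonneg (by linarith)] at key

/-- If `γ n` moves the base point to `ξ` and `(γ n)⁻¹` moves it to a point different from a fixed
point of a rank one isometry, then `γ n` moves this fixed point to `ξ`. -/
theorem IsRankOneAxis.eventually_map_rep_mem (A : IsRankOneAxis h σ l) {F : Filter ℕ} {x : X}
    {γ : ℕ → X ≃ᵢ X} {ξ η : Boundary X} (hη : η ≠ A.rep)
    (h1 : ∀ R : ℝ≥0, ∀ᶠ n in F, Compactification.pt (γ n x) ∈ coneNhd x ξ R 1)
    (h2 : ∀ R : ℝ≥0, ∀ᶠ n in F, Compactification.pt ((γ n).symm x) ∈ coneNhd x η R 1)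
    {U : Set (Boundary X)} (hU : U ∈ 𝓝 ξ) : ∀ᶠ n in F, Boundary.map (γ n) A.rep ∈ U := by
  obtain ⟨R, C, N, hC, hnear⟩ := A.exists_near hη
  obtain ⟨R', hR'⟩ := exists_coneNhd_subset (y := σ 0) (η := η) (ξ := η) (R := R) (ε := 1)
    (by rw [mem_coneNhd]; exact ⟨trivial, by simp [toward]⟩) x
  obtain ⟨S, hS⟩ := exists_subset_of_mem_nhds_boundary x hU
  have hS0 : (0 : ℝ) ≤ S := S.coe_nonneg
  set C' := C + dist (σ 0) x with hC'
  have hC'0 : 0 ≤ C' := add_nonneg hC dist_nonneg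
  -- `Q` keeps both `S / Q` and `2 * S * C' / (Q - C')` at most `1 / 2`: the errors of replacing `ξ`
  -- by `γ n x`, and `γ n x` by the image of the fixed point.
  set Q : ℝ≥0 := ⟨C' + S + 4 * S * C' + 2 * S + 1, by positivity⟩ with hQ
  have hQ' : (Q : ℝ) = C' + S + 4 * S * C' + 2 * S + 1 := rfl
  have hSC : 0 ≤ S * C' := by positivity
  filter_upwards [h1 Q, h2 R'] with n hn1 hn2
  refine hS _ ?_
  rw [mem_coneNhd] at hn1
  have hD : (Q : ℝ) < dist x (γ n x) := hn1.1
  have hSQ : S ≤ Q := by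
    have : (S : ℝ) ≤ Q := by rw [hQ']; nlinarith
    exact this
  have a1 : dist (seg x (γ n x) S) (rayTo x ξ S) < 1 / 2 := by
    have h3 := dist_toward_le hSQ hn1.1 (w := .bd ξ) trivial
    have h4 : (S : ℝ) / Q * dist (toward x (.pt (γ n x)) Q) (rayTo x ξ Q) ≤ S / Q :=
      mul_le_of_le_one_right (by positivity) hn1.2.le
    have h5 : (S : ℝ) / Q < 1 / 2 := by
      rw [div_lt_div_iff₀ (by rw [hQ']; positivity) two_pos, hQ']
      nlinarith
    exact lt_of_le_of_lt (h3.trans h4) h5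
  have a2 : dist (rayTo x (Boundary.map (γ n) A.rep) S) (seg x (γ n x) S) ≤ 1 / 2 := by
    have hlim := (tendsto_seg_ray x ((lineRay A.inv.isometry).map (γ n)) S).dist
      (tendsto_const_nhds (x := seg x (γ n x) S))
    refine le_of_tendsto hlim ?_
    filter_upwards [NNReal.tendsto_coe_atTop.2 tendsto_id |>.eventually_ge_atTop N] with m hm
    -- The geodesic from `σ (-m)` to `(γ n)⁻¹ x` passes near `σ 0`, so its image, a geodesic ending
    -- at `x`, passes within `C'` of `γ n x`.
    obtain ⟨b, hb, hbC⟩ := hnear _ (hR' hn2) m hm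
    have hb' := map_mem_segSet (γ n) hb
    rw [IsometryEquiv.apply_symm_apply, segSet_comm] at hb'
    have key := dist_seg_seg_le_of_near (a := γ n x) (D := Q) (C := C') (t := S) hb' (by
      rw [IsometryEquiv.dist_eq]
      exact (dist_triangle _ (σ 0) _).trans (by linarith)) hD.le hS0 (by rw [hQ']; nlinarith)
      (by rw [hQ']; nlinarith)
    refine le_trans key ?_
    rw [div_le_div_iff₀ (by rw [hQ']; nlinarith) two_pos, hQ']
    nlinarith
  have := dist_triangle (rayTo x (Boundary.map (γ n) A.rep) S) (seg x (γ n x) S) (rayTo x ξ S)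
  linarith

end Dynamics

/-! ### Independent isometries have distinct fixed points. -/

section Independence

variable {X : Type u} [MetricSpace X]

theorem Independent.inv_left {g h : X ≃ᵢ X} (H : Independent g h) : Independent g⁻¹ h := by
  intro x
  have := (H x).comp ((Homeomorph.neg ℤ).prodCongr (Homeomorph.refl ℤ)).isProperMap
  refine (congrArg IsProperMap ?_).mp this
  ext p
  simp [inv_zpow']

theorem Independent.inv_right {g h : X ≃ᵢ X} (H : Independent g h) : Independent g h⁻¹ := by
  intro x
  have := (H x).comp ((Homeomorph.refl ℤ).prodCongr (Homeomorph.neg ℤ)).isProperMap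
  refine (congrArg IsProperMap ?_).mp this
  ext p
  simp [inv_zpow']

/-- If the axes were asymptotic, `g ^ m` and `h ^ n` with `n = ⌊m * l / l'⌋₊` would move `σ 0` to
points within `K` of each other for every `m`, whereas properness leaves finitely many such pairs.
-/
theorem Independent.attr_ne_attr {g h : X ≃ᵢ X} (H : Independent g h) {σ τ : ℝ → X} {l l' : ℝ}
    (A : IsRankOneAxis g σ l) (B : IsRankOneAxis h τ l') : A.attr ≠ B.attr := by
  intro he
  obtain ⟨C, hC⟩ := Ray.endpoint_eq_iff.1 he
  set K := C + l' + dist (τ 0) (σ 0) with hK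
  have hbound : ∀ m : ℕ, dist ((g ^ m) (σ 0)) ((h ^ ⌊m * l / l'⌋₊) (σ 0)) ≤ K := by
    intro m
    have hml : 0 ≤ m * l := mul_nonneg m.cast_nonneg A.pos.le
    set n := ⌊m * l / l'⌋₊ with hn
    have h1 : (n : ℝ) * l' ≤ m * l := by
      rw [← le_div_iff₀ B.pos]
      exact Nat.floor_le (div_nonneg hml B.pos.le)
    have h2 : m * l < (n + 1) * l' := by
      rw [← div_lt_iff₀ B.pos]
      exact Nat.lt_floor_add_one _
    rw [A.pow_apply, zero_add]
    have e1 : dist (σ (m * l)) (τ (m * l)) ≤ C := hC ⟨m * l, hml⟩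
    have e2 : dist (τ (m * l)) (τ (n * l')) ≤ l' := by
      rw [B.isometry.dist_eq, Real.dist_eq, abs_of_nonneg (by linarith)]
      linarith
    have e3 : dist (τ (n * l')) ((h ^ n) (σ 0)) = dist (τ 0) (σ 0) := by
      have := B.pow_apply n 0
      rw [zero_add] at this
      rw [← this, IsometryEquiv.dist_eq]
    have t1 := dist_triangle (σ (m * l)) (τ (m * l)) ((h ^ n) (σ 0))
    have t2 := dist_triangle (τ (m * l)) (τ (n * l')) ((h ^ n) (σ 0))
    linarith
  have hfin := ((H (σ 0)).isCompact_preimage (isCompact_Icc (a := 0) (b := K))).finite_of_discrete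
  refine Set.infinite_of_injective_forall_mem (f := fun m : ℕ => ((m : ℤ), (⌊m * l / l'⌋₊ : ℤ)))
    (fun m m' hm => ?_) (fun m => ?_) hfin
  · have h1 : (m : ℤ) = m' := (Prod.ext_iff.1 hm).1
    exact_mod_cast h1
  · refine ⟨dist_nonneg, ?_⟩
    simpa using hbound m

end Independence

/-! ### Orbits of points other than the fixed points are injective. -/

section ChoiceOfPower

variable {X : Type u} [MetricSpace X] [IsCNSpace X] [ProperSpace X]

theorem IsRankOneAxis.setOf_map_pow_eq_subsingleton {h : X ≃ᵢ X} {σ : ℝ → X} {l : ℝ}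
    (A : IsRankOneAxis h σ l) {ξ : Boundary X} (h1 : ξ ≠ A.attr) (h2 : ξ ≠ A.rep)
    (η : Boundary X) : {n : ℕ | Boundary.map (h ^ n) ξ = η}.Subsingleton := by
  have key : ∀ n d : ℕ, 0 < d → Boundary.map (h ^ n) ξ ≠ Boundary.map (h ^ (n + d)) ξ := by
    intro n d hd he
    rw [pow_add, Boundary.map_mul] at he
    have := congrArg (Boundary.map (h ^ n)⁻¹) he
    rw [Boundary.map_inv_map, Boundary.map_inv_map] at this
    exact h1 (A.eq_attr_of_map_pow_eq h2 hd this.symm)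
  intro m hm n hn
  have hm' : Boundary.map (h ^ m) ξ = η := hm
  have hn' : Boundary.map (h ^ n) ξ = η := hn
  rcases lt_trichotomy m n with hlt | rfl | hlt
  · have := key m (n - m) (by omega)
    rw [Nat.add_sub_cancel' hlt.le, hm', hn'] at this
    exact absurd rfl this
  · rfl
  · have := key n (m - n) (by omega)
    rw [Nat.add_sub_cancel' hlt.le, hm', hn'] at this
    exact absurd rfl this

end ChoiceOfPower

/-! ### The product, its Furstenberg limit set, and regular axial elements. -/

section ProductSpace

variable {r : ℕ} {X : Fin r → Type u} [∀ i, MetricSpace (X i)]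

theorem piLp_dist_sq (x y : PiLp 2 X) : dist x y ^ 2 = ∑ i, dist (x i) (y i) ^ 2 := by
  rw [PiLp.dist_eq_sum (by norm_num)]
  simp only [ENNReal.toReal_ofNat, Real.rpow_ofNat]
  rw [← Real.sqrt_eq_rpow, Real.sq_sqrt (Finset.sum_nonneg fun i _ => sq_nonneg _)]

theorem dist_apply_le (x y : PiLp 2 X) (i : Fin r) : dist (x i) (y i) ≤ dist x y := by
  refine abs_le_of_sq_le_sq' ?_ dist_nonneg |>.2
  rw [piLp_dist_sq]
  exact Finset.single_le_sum (f := fun i => dist (x i) (y i) ^ 2) (fun i _ => sq_nonneg _)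
    (Finset.mem_univ i)

instance [∀ i, IsCNSpace (X i)] : IsCNSpace (PiLp 2 X) := by
  refine ⟨fun x y s hs => ⟨WithLp.toLp 2 fun i => geo (x i) (y i) s, fun p => ?_⟩⟩
  rw [piLp_dist_sq, piLp_dist_sq, piLp_dist_sq, piLp_dist_sq, Finset.mul_sum, Finset.mul_sum,
    Finset.mul_sum, ← Finset.sum_add_distrib, ← Finset.sum_sub_distrib]
  exact Finset.sum_le_sum fun i _ => dist_geo_sq_le _ _ _ hs

instance [∀ i, ProperSpace (X i)] : ProperSpace (PiLp 2 X) := by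
  refine ⟨fun o R => ?_⟩
  have hK : IsCompact (Set.pi univ fun i => Metric.closedBall (o i) R) :=
    isCompact_univ_pi fun i => isCompact_closedBall _ _
  refine (hK.image (PiLp.continuous_toLp 2 X)).of_isClosed_subset Metric.isClosed_closedBall ?_
  intro y hy
  exact ⟨fun i => y i, fun i _ => (dist_apply_le y o i).trans hy, rfl⟩

theorem geo_apply [∀ i, IsCNSpace (X i)] (x y : PiLp 2 X) {s : ℝ} (hs : s ∈ Icc (0 : ℝ) 1)
    (i : Fin r) : geo x y s i = geo (x i) (y i) s := by
  have : WithLp.toLp 2 (fun i => geo (x i) (y i) s) = geo x y s := by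
    refine eq_geo hs ?_ ?_
    · refine abs_le_of_sq_le_sq' ?_ (mul_nonneg hs.1 dist_nonneg) |>.2
      rw [mul_pow, piLp_dist_sq, piLp_dist_sq, Finset.mul_sum]
      refine Finset.sum_le_sum fun i _ => ?_
      change dist (x i) (geo (x i) (y i) s) ^ 2 ≤ _
      rw [dist_left_geo _ _ hs, mul_pow]
    · refine abs_le_of_sq_le_sq' ?_ (mul_nonneg (by linarith [hs.2]) dist_nonneg) |>.2
      rw [mul_pow, piLp_dist_sq, piLp_dist_sq, Finset.mul_sum]
      refine Finset.sum_le_sum fun i _ => ?_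
      change dist (geo (x i) (y i) s) (y i) ^ 2 ≤ _
      rw [dist_geo_right _ _ hs, mul_pow]
  rw [← this]

/-- The action of an element of `Is(X₁) × ⋯ × Is(X_r)` on the product, as an isometry. -/
def actIso (γ : ∀ i, X i ≃ᵢ X i) : PiLp 2 X ≃ᵢ PiLp 2 X where
  toFun := act γ
  invFun := act γ⁻¹
  left_inv x := by
    ext i
    exact (γ i).symm_apply_apply (x i)
  right_inv x := by
    ext i
    exact (γ i).apply_symm_apply (x i)
  isometry_toFun := Isometry.of_dist_eq fun x y => by
    rw [← sq_eq_sq₀ dist_nonneg dist_nonneg, piLp_dist_sq, piLp_dist_sq]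
    exact Finset.sum_congr rfl fun i _ => by
      change dist (γ i (x i)) (γ i (y i)) ^ 2 = _
      rw [(γ i).isometry.dist_eq]

theorem slope_map (γ : ∀ i, X i ≃ᵢ X i) (ρ : Ray (PiLp 2 X)) :
    slope (ρ.map (actIso γ)) = slope ρ := by
  ext i
  change dist (γ i (ρ 0 i)) (γ i (ρ 1 i)) = dist (ρ 0 i) (ρ 1 i)
  rw [(γ i).isometry.dist_eq]

theorem actF_mul (γ δ : ∀ i, X i ≃ᵢ X i) (ξ : FurstenbergBoundary X) :
    actF (γ * δ) ξ = actF γ (actF δ ξ) :=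
  funext fun i => Boundary.map_mul (γ i) (δ i) (ξ i)

theorem actF_actF_inv (γ : ∀ i, X i ≃ᵢ X i) (ξ : FurstenbergBoundary X) :
    actF γ (actF γ⁻¹ ξ) = ξ :=
  funext fun i => Boundary.map_map_inv (γ i) (ξ i)

variable [∀ i, IsCNSpace (X i)]

theorem dist_ray_apply (ρ : Ray (PiLp 2 X)) (t : ℝ≥0) (i : Fin r) :
    dist (ρ 0 i) (ρ t i) = slope ρ i * t := by
  have key : ∀ {a b : ℝ≥0}, a ≤ b → dist (ρ 0 i) (ρ a i) = a / b * dist (ρ 0 i) (ρ b i) := by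
    intro a b hab
    have hu := div_mem_unit a.coe_nonneg (NNReal.coe_le_coe.2 hab)
    rw [← ρ.geo_eq hab, geo_apply _ _ hu, dist_left_geo _ _ hu]
  change _ = dist (ρ 0 i) (ρ 1 i) * t
  rcases le_total t 1 with h | h
  · rw [key h]
    simp [mul_comm]
  · have h0 : (0 : ℝ) < t := lt_of_lt_of_le zero_lt_one (NNReal.coe_le_coe.2 h)
    rw [key h]
    push_cast
    field_simp

/-- Regularity is tested on one representing ray and the projection uses another; a coordinate with
positive slope escapes linearly and cannot stay near a constant one. -/
theorem slope_pos_of_endpoint_eq {ρ ρ' : Ray (PiLp 2 X)} (h : ρ.endpoint = ρ'.endpoint) {i : Fin r}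
    (hi : 0 < slope ρ i) : 0 < slope ρ' i := by
  by_contra hcon
  have h0 : slope ρ' i = 0 := le_antisymm (not_lt.1 hcon) bot_le
  have hpos : (0 : ℝ) < slope ρ i := hi
  set D := dist (ρ 0) (ρ' 0)
  have hD : 0 ≤ D := dist_nonneg
  set t : ℝ≥0 := ⟨(2 * D + 1) / slope ρ i, by positivity⟩ with ht
  have ht' : slope ρ i * (t : ℝ) = 2 * D + 1 := mul_div_cancel₀ _ hpos.ne'
  have h1 := dist_ray_apply ρ t i
  have h2 := dist_ray_apply ρ' t i
  rw [h0, NNReal.coe_zero, zero_mul] at h2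
  have h3 := (dist_apply_le (ρ t) (ρ' t) i).trans (dist_ray_le h t)
  have h4 := dist_apply_le (ρ 0) (ρ' 0) i
  have t1 := dist_triangle (ρ 0 i) (ρ' 0 i) (ρ t i)
  have t2 := dist_triangle (ρ' 0 i) (ρ' t i) (ρ t i)
  rw [dist_comm (ρ' t i)] at t2
  rw [h1, ht'] at t1
  linarith

variable [∀ i, ProperSpace (X i)]

theorem image_furstenbergLimitSet_subset (Γ : Subgroup (∀ i, X i ≃ᵢ X i)) (x : PiLp 2 X)
    {γ : ∀ i, X i ≃ᵢ X i} (hγ : γ ∈ Γ) :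
    actF γ '' furstenbergLimitSet Γ x ⊆ furstenbergLimitSet Γ x := by
  rintro _ ⟨ξ, ⟨ζ, ⟨hζ, ρ₀, hρ₀, hpos⟩, ρ, hρ, ρ', hρ', hcoord⟩, rfl⟩
  refine ⟨Boundary.map (actIso γ) ζ, ⟨?_, ρ₀.map (actIso γ), ?_, ?_⟩, ρ.map (actIso γ), ?_,
    fun i => (ρ' i).map (γ i), fun i => ?_, fun t i => ?_⟩
  · refine map_mem_closure (x := Compactification.bd ζ)
      (continuous_compactification_map (actIso γ)) hζ ?_
    rintro _ ⟨δ, hδ, rfl⟩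
    exact ⟨γ * δ, Γ.mul_mem hγ hδ, rfl⟩
  · rw [← hρ₀]; rfl
  · rwa [slope_map]
  · rw [← hρ]; rfl
  · change Boundary.map (γ i) (ρ' i).endpoint = Boundary.map (γ i) (ξ i)
    rw [hρ' i]
  · rw [slope_map]
    exact congrArg (γ i) (hcoord t i)

theorem image_furstenbergLimitSet (Γ : Subgroup (∀ i, X i ≃ᵢ X i)) (x : PiLp 2 X)
    {γ : ∀ i, X i ≃ᵢ X i} (hγ : γ ∈ Γ) :
    actF γ '' furstenbergLimitSet Γ x = furstenbergLimitSet Γ x := by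
  refine (image_furstenbergLimitSet_subset Γ x hγ).antisymm fun ξ hξ => ?_
  exact ⟨actF γ⁻¹ ξ, image_furstenbergLimitSet_subset Γ x (Γ.inv_mem hγ) ⟨ξ, hξ, rfl⟩,
    actF_actF_inv γ ξ⟩

/-- The orbit points near a regular limit point converge in every factor. -/
theorem exists_mem_coneNhd_of_mem_furstenbergLimitSet {Γ : Subgroup (∀ i, X i ≃ᵢ X i)}
    {x : PiLp 2 X} {ξ : FurstenbergBoundary X} (hξ : ξ ∈ furstenbergLimitSet Γ x)
    (R : ℝ≥0) (q : ∀ i, X i) :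
    ∃ γ ∈ Γ, ∀ i, Compactification.pt (γ i (x i)) ∈ coneNhd (q i) (ξ i) R 1 := by
  obtain ⟨ζ, ⟨hζ, ρ₀, hρ₀, hpos₀⟩, ρ, hρ, ρ', hρ', hcoord⟩ := hξ
  have hpos : ∀ i, 0 < slope ρ i := fun i =>
    slope_pos_of_endpoint_eq (hρ₀.trans hρ.symm) (hpos₀ i)
  have hsub : ∀ i, ∃ S : ℝ≥0, coneNhd (ρ 0 i) (ξ i) S 1 ⊆ coneNhd (q i) (ξ i) R 1 := fun i =>
    exists_coneNhd_subset (by rw [mem_coneNhd]; exact ⟨trivial, by simp [toward]⟩) _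
  choose S hS using hsub
  -- The sum dominates each summand, so at time `T` every coordinate of `ρ` has travelled at least
  -- `S i + 1`; the extra 1 absorbs the error `1 / 4`.
  set T : ℝ≥0 := ∑ i, (S i + 1) / slope ρ i with hT
  have hTi : ∀ i, S i + 1 ≤ slope ρ i * T := by
    intro i
    have h1 : (S i + 1) / slope ρ i ≤ T :=
      Finset.single_le_sum (f := fun i => (S i + 1) / slope ρ i) (fun _ _ => bot_le)
        (Finset.mem_univ i)
    calc S i + 1 = slope ρ i * ((S i + 1) / slope ρ i) :=
          (mul_div_cancel₀ _ (hpos i).ne').symm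
      _ ≤ _ := mul_le_mul_right h1 _
  obtain ⟨_, hz, γ, hγ, rfl⟩ := mem_closure_iff_nhds.1 hζ _
    (coneNhd_mem_nhds (ρ 0) ζ T (ε := 1 / 4) (by norm_num))
  rw [mem_coneNhd, ← eq_rayTo rfl hρ] at hz
  refine ⟨γ, hγ, fun i => hS i ?_⟩
  have hfar : (T : ℝ) < dist (ρ 0) (act γ x) := hz.1
  have hu := div_mem_unit T.coe_nonneg hfar.le
  set s : ℝ := T / dist (ρ 0) (act γ x) with hs
  set a := s * dist (ρ 0 i) (γ i (x i)) with ha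
  have hoρ : ρ 0 i = ρ' i 0 := by rw [hcoord, mul_zero]
  have hA : geo (ρ 0 i) (γ i (x i)) s = seg (ρ 0 i) (γ i (x i)) a := by
    rcases (dist_nonneg (x := ρ 0 i) (y := γ i (x i))).eq_or_lt with h | h
    · rw [ha, ← h, mul_zero, seg_zero, ← dist_eq_zero.1 h.symm, geo_self _ hu]
    · rw [seg_def, ha, mul_div_assoc, div_self h.ne', mul_one]
  have had : a ≤ dist (ρ 0 i) (γ i (x i)) := mul_le_of_le_one_left dist_nonneg hu.2
  have ha0 : 0 ≤ a := mul_nonneg hu.1 dist_nonneg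
  have hdA : dist (ρ 0 i) (seg (ρ 0 i) (γ i (x i)) a) = a := dist_left_seg ha0 had
  have hdB : dist (ρ 0 i) (ρ' i (slope ρ i * T)) = slope ρ i * T := by
    rw [hoρ, Ray.dist_zero, NNReal.coe_mul]
  have hAB : dist (seg (ρ 0 i) (γ i (x i)) a) (ρ' i (slope ρ i * T)) < 1 / 4 := by
    have h1 := (dist_apply_le (seg (ρ 0) (act γ x) T) (ρ T) i).trans_lt hz.2
    have h2 : seg (ρ 0) (act γ x) T i = geo (ρ 0 i) (γ i (x i)) s := geo_apply _ _ hu i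
    rwa [h2, hA, hcoord T i] at h1
  have hST : (S i : ℝ) + 1 ≤ slope ρ i * T := by exact_mod_cast hTi i
  have hSa : (S i : ℝ) + 1 / 2 < a := by
    have := dist_triangle (ρ 0 i) (seg (ρ 0 i) (γ i (x i)) a) (ρ' i (slope ρ i * T))
    rw [hdA, hdB] at this
    linarith
  have hS0 : (0 : ℝ) ≤ S i := (S i).coe_nonneg
  rw [mem_coneNhd, ← eq_rayTo hoρ.symm (hρ' i)]
  refine ⟨show (S i : ℝ) < dist (ρ 0 i) (γ i (x i)) by linarith, ?_⟩
  change dist (seg (ρ 0 i) (γ i (x i)) (S i)) _ < 1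
  have hSle : S i ≤ slope ρ i * T := le_trans (by simp) (hTi i)
  rw [← seg_seg hS0 (by linarith : (S i : ℝ) ≤ a) had, ← (ρ' i).seg_eq hSle, ← hoρ]
  refine (dist_seg_seg_left_le hS0 (by linarith) (by rw [hdB]; linarith)).trans_lt ?_
  rw [hdA, div_lt_one (by linarith)]
  nlinarith

/-- Run at speeds `l i / L`, the axes of the factors form an axis of `k` with translation length `L`
and all slopes positive; the points `k ^ n x` stay at bounded distance from it. -/
theorem attr_mem_furstenbergLimitSet (hr : 1 ≤ r) {Γ : Subgroup (∀ i, X i ≃ᵢ X i)} (x : PiLp 2 X)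
    {k : ∀ i, X i ≃ᵢ X i} (hk : k ∈ Γ) {σ : ∀ i, ℝ → X i} {l : Fin r → ℝ}
    (A : ∀ i, IsRankOneAxis (k i) (σ i) (l i)) :
    (fun i => (A i).attr) ∈ furstenbergLimitSet Γ x := by
  have hsum : 0 < ∑ i, l i ^ 2 := by
    have : Nonempty (Fin r) := ⟨⟨0, hr⟩⟩
    exact Finset.sum_pos (fun i _ => pow_pos (A i).pos 2) Finset.univ_nonempty
  set L := √(∑ i, l i ^ 2) with hL
  have hL0 : 0 < L := Real.sqrt_pos.2 hsum
  have hL2 : L ^ 2 = ∑ i, l i ^ 2 := Real.sq_sqrt hsum.le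
  have hdist : ∀ s t : ℝ, dist (WithLp.toLp 2 fun i => σ i (l i / L * s) : PiLp 2 X)
      (WithLp.toLp 2 fun i => σ i (l i / L * t)) = |s - t| := by
    intro s t
    rw [← sq_eq_sq₀ dist_nonneg (abs_nonneg _), piLp_dist_sq, sq_abs]
    have : ∀ i, dist (σ i (l i / L * s)) (σ i (l i / L * t)) ^ 2 =
        l i ^ 2 * ((s - t) ^ 2 / L ^ 2) := by
      intro i
      rw [(A i).isometry.dist_eq, Real.dist_eq, sq_abs]
      field_simp
    change ∑ i, dist (σ i (l i / L * s)) (σ i (l i / L * t)) ^ 2 = _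
    simp only [this]
    rw [← Finset.sum_mul, ← hL2]
    field_simp
  let ρ : Ray (PiLp 2 X) := ⟨fun t => WithLp.toLp 2 fun i => σ i (l i / L * t),
    Isometry.of_dist_eq fun s t => by rw [hdist, NNReal.dist_eq]⟩
  have hslope : ∀ i, (slope ρ i : ℝ) = l i / L := by
    intro i
    change dist (σ i (l i / L * (0 : ℝ≥0))) (σ i (l i / L * (1 : ℝ≥0))) = _
    rw [(A i).isometry.dist_eq, Real.dist_eq]
    simp [abs_of_pos (A i).pos, abs_of_pos hL0, abs_div]
  refine ⟨ρ.endpoint, ⟨?_, ρ, rfl, fun i => ?_⟩, ρ, rfl, fun i => lineRay (A i).isometry,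
    fun i => rfl, fun t i => ?_⟩
  · refine mem_closure_iff_nhds.2 fun U hU => ?_
    obtain ⟨R, hR⟩ := exists_coneNhd_subset_of_mem_nhds (ρ 0) hU
    set C := dist (ρ 0) x with hC
    have hC0 : 0 ≤ C := dist_nonneg
    have hR0 : (0 : ℝ) ≤ R := R.coe_nonneg
    have hRC : 0 ≤ 2 * R * C := by positivity
    obtain ⟨n, hn⟩ := exists_nat_ge ((2 * C + 2 * R * C + R + 1) / L)
    rw [div_le_iff₀ hL0] at hn
    have hnL : 0 ≤ n * L := mul_nonneg n.cast_nonneg hL0.le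
    set N : ℝ≥0 := ⟨n * L, hnL⟩ with hN
    have hρN : act (k ^ n) (ρ 0) = ρ N := by
      ext i
      change (k i ^ n) (σ i (l i / L * (0 : ℝ≥0))) = σ i (l i / L * (n * L))
      rw [(A i).pow_apply]
      congr 1
      rw [NNReal.coe_zero]
      field_simp
      ring
    have hnear : dist (ρ N) (act (k ^ n) x) = C := by
      rw [← hρN]
      exact (actIso (k ^ n)).isometry.dist_eq _ _
    have hfar : n * L - C ≤ dist (ρ 0) (act (k ^ n) x) := by
      have := dist_triangle (ρ 0) (act (k ^ n) x) (ρ N)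
      rw [ρ.dist_zero, dist_comm (act _ _), hnear] at this
      change n * L ≤ _ at this
      linarith
    refine ⟨.pt (act (k ^ n) x), hR ?_, k ^ n, Γ.pow_mem hk n, rfl⟩
    rw [mem_coneNhd, ← eq_rayTo rfl rfl]
    refine ⟨show (R : ℝ) < _ by linarith, ?_⟩
    have hRN : R ≤ N := by
      have : (R : ℝ) ≤ n * L := by linarith
      exact this
    have key := dist_seg_seg_le_of_near (x := ρ 0) (y := ρ N) (b := ρ N) (a := act (k ^ n) x)
      (by simp) hnear.le hfar hR0 (by linarith) (by linarith)
    rw [ρ.seg_eq hRN, dist_comm] at key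
    refine key.trans_lt ?_
    rw [div_lt_one (by linarith)]
    linarith
  · have := div_pos (A i).pos hL0
    rw [← hslope i] at this
    exact this
  · change σ i (l i / L * t) = σ i ((slope ρ i * t : ℝ≥0) : ℝ)
    rw [NNReal.coe_mul, hslope]

/-- Conjugating `g` by `h ^ n` moves its fixed points by `h ^ n`. In each factor each forbidden
coincidence happens for at most one `n`, so some `n` avoids all of them simultaneously. -/
theorem exists_regularAxial_avoiding {Γ : Subgroup (∀ i, X i ≃ᵢ X i)}
    (hreg : ∃ g ∈ Γ, ∃ h ∈ Γ, IsRegularAxial g ∧ IsRegularAxial h ∧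
      ∀ i, Independent (g i) (h i)) (a b c : FurstenbergBoundary X) :
    ∃ k ∈ Γ, ∃ (σ : ∀ i, ℝ → X i) (l : Fin r → ℝ) (A : ∀ i, IsRankOneAxis (k i) (σ i) (l i)),
      ∀ i, a i ≠ (A i).rep ∧ b i ≠ (A i).rep ∧ c i ≠ (A i).attr := by
  obtain ⟨g, hg, h, hh, hgr, hhr, hind⟩ := hreg
  choose l σ hl hσ hgσ hgf using hgr
  choose l' τ hl' hτ hhτ hhf using hhr
  have A : ∀ i, IsRankOneAxis (g i) (σ i) (l i) := fun i => ⟨hl i, hσ i, hgσ i, hgf i⟩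
  have B : ∀ i, IsRankOneAxis (h i) (τ i) (l' i) := fun i => ⟨hl' i, hτ i, hhτ i, hhf i⟩
  have n1 : ∀ i, (A i).attr ≠ (B i).attr := fun i => (hind i).attr_ne_attr _ _
  have n2 : ∀ i, (A i).attr ≠ (B i).rep := fun i => (hind i).inv_right.attr_ne_attr _ (B i).inv
  have n3 : ∀ i, (A i).rep ≠ (B i).attr := fun i => (hind i).inv_left.attr_ne_attr (A i).inv _
  have n4 : ∀ i, (A i).rep ≠ (B i).rep := fun i =>
    (hind i).inv_left.inv_right.attr_ne_attr (A i).inv (B i).inv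
  have hfin : (⋃ i, ({n : ℕ | Boundary.map (h i ^ n) (A i).rep = a i} ∪
      {n : ℕ | Boundary.map (h i ^ n) (A i).rep = b i} ∪
      {n : ℕ | Boundary.map (h i ^ n) (A i).attr = c i})).Finite :=
    Set.finite_iUnion fun i =>
      (((B i).setOf_map_pow_eq_subsingleton (n3 i) (n4 i) _).finite.union
        ((B i).setOf_map_pow_eq_subsingleton (n3 i) (n4 i) _).finite).union
        ((B i).setOf_map_pow_eq_subsingleton (n1 i) (n2 i) _).finite
  obtain ⟨n, hn⟩ := hfin.exists_notMem
  rw [mem_iUnion, not_exists] at hn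
  refine ⟨h ^ n * g * (h ^ n)⁻¹, Γ.mul_mem (Γ.mul_mem (Γ.pow_mem hh n) hg)
    (Γ.inv_mem (Γ.pow_mem hh n)), _, l, fun i => (A i).conj (h i ^ n), fun i => ⟨?_, ?_, ?_⟩⟩
  · exact fun he => hn i (Or.inl (Or.inl he.symm))
  · exact fun he => hn i (Or.inl (Or.inr he.symm))
  · exact fun he => hn i (Or.inr he.symm)

theorem exists_nhds_pow_image_subset {k : ∀ i, X i ≃ᵢ X i} {σ : ∀ i, ℝ → X i} {l : Fin r → ℝ}
    (A : ∀ i, IsRankOneAxis (k i) (σ i) (l i)) {ζ : FurstenbergBoundary X}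
    (hζ : ∀ i, ζ i ≠ (A i).rep) :
    ∃ V ∈ 𝓝 ζ, ∀ U ∈ 𝓝 (fun i => (A i).attr : FurstenbergBoundary X),
      ∀ᶠ j : ℕ in atTop, actF (k ^ j) '' V ⊆ U := by
  choose V hV hVU using fun i => (A i).exists_nhds_pow_subset (hζ i)
  refine ⟨Set.pi univ V, set_pi_mem_nhds finite_univ fun i _ => hV i, fun U hU => ?_⟩
  rw [nhds_pi, Filter.mem_pi'] at hU
  obtain ⟨I, t, ht, htU⟩ := hU
  choose J hJ using fun i => hVU i (t i) (ht i)
  filter_upwards [eventually_ge_atTop (Finset.univ.sup J)] with j hj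
  rintro _ ⟨z, hz, rfl⟩
  exact htU fun i _ => hJ i j ((Finset.le_sup (Finset.mem_univ i)).trans hj) _ (hz i (mem_univ i))

theorem continuous_actF (γ : ∀ i, X i ≃ᵢ X i) : Continuous (actF γ) :=
  continuous_pi fun i => (continuous_boundary_map (γ i)).comp (continuous_apply i)

theorem exists_mem_coneNhd_eventually {X : Type u} [MetricSpace X] [IsCNSpace X] [ProperSpace X]
    (F : Ultrafilter ℕ) (x : X) (y : ℕ → X) (hy : Tendsto (fun n => dist x (y n)) F atTop) :
    ∃ η : Boundary X, ∀ R : ℝ≥0, ∀ᶠ n in (F : Filter ℕ),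
      Compactification.pt (y n) ∈ coneNhd x η R 1 := by
  obtain ⟨ρ, h0, hρ⟩ := exists_ray_tendsto_seg F x y hy
  refine ⟨ρ.endpoint, fun R => ?_⟩
  filter_upwards [hy.eventually_gt_atTop (R : ℝ),
    (hρ R).eventually (Metric.ball_mem_nhds _ one_pos)] with n h1 h2
  rw [mem_coneNhd, ← eq_rayTo h0 rfl]
  exact ⟨h1, h2⟩

theorem exists_actF_mem {Γ : Subgroup (∀ i, X i ≃ᵢ X i)}
    (hreg : ∃ g ∈ Γ, ∃ h ∈ Γ, IsRegularAxial g ∧ IsRegularAxial h ∧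
      ∀ i, Independent (g i) (h i)) {x : PiLp 2 X} (ζ : FurstenbergBoundary X)
    {U : Set (FurstenbergBoundary X)} (hU : IsOpen U)
    (hne : (U ∩ furstenbergLimitSet Γ x).Nonempty) : ∃ γ ∈ Γ, actF γ ζ ∈ U := by
  obtain ⟨ξ, hξU, hξ⟩ := hne
  choose γ hγ hγx using fun n : ℕ =>
    exists_mem_coneNhd_of_mem_furstenbergLimitSet hξ (n : ℝ≥0) (fun i => x i)
  have hev : ∀ i (R : ℝ≥0), ∀ᶠ n in (hyperfilter ℕ : Filter ℕ),
      Compactification.pt (γ n i (x i)) ∈ coneNhd (x i) (ξ i) R 1 := by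
    intro i R
    obtain ⟨N, hN⟩ := exists_nat_ge R
    refine Nat.hyperfilter_le_atTop ?_
    filter_upwards [eventually_ge_atTop N] with n hn
    exact coneNhd_anti _ _ (hN.trans (by exact_mod_cast hn)) _ (hγx n i)
  have hback : ∀ i, Tendsto (fun n => dist (x i) ((γ n i).symm (x i))) (hyperfilter ℕ) atTop := by
    intro i
    refine tendsto_atTop_mono (fun n => ?_)
      ((tendsto_natCast_atTop_atTop (R := ℝ)).mono_left Nat.hyperfilter_le_atTop)
    have h1 := (mem_coneNhd.1 (hγx n i)).1
    have h2 : ((n : ℝ≥0) : ℝ) < dist (x i) (γ n i (x i)) := h1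
    rw [← (γ n i).isometry.dist_eq, IsometryEquiv.apply_symm_apply, dist_comm]
    exact_mod_cast h2.le
  -- `(γ n i)⁻¹` displaces `x i` as far as `γ n i` does, so the backward orbit converges along the
  -- ultrafilter to a boundary point in each factor.
  choose η hη using fun i => exists_mem_coneNhd_eventually _ (x i) _ (hback i)
  obtain ⟨k, hk, σ, l, A, hA⟩ := exists_regularAxial_avoiding hreg ζ ζ η
  have hlim : Tendsto (fun n => actF (γ n) fun i => (A i).attr) (hyperfilter ℕ) (𝓝 ξ) := by
    refine tendsto_pi_nhds.2 fun i V hV => ?_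
    -- The attracting point of `k i` is the repelling point of its inverse.
    have := (A i).inv.eventually_map_rep_mem (by rw [(A i).rep_inv]; exact (hA i).2.2)
      (hev i) (hη i) hV
    rwa [(A i).rep_inv] at this
  obtain ⟨n, hn⟩ := (hlim.eventually (hU.mem_nhds hξU)).exists
  obtain ⟨V, hV, hVU⟩ := exists_nhds_pow_image_subset A fun i => (hA i).1
  obtain ⟨j, hj⟩ := (hVU _ ((continuous_actF (γ n)).continuousAt.preimage_mem_nhds
    (hU.mem_nhds hn))).exists
  refine ⟨γ n * k ^ j, Γ.mul_mem (hγ n) (Γ.pow_mem hk j), ?_⟩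
  rw [actF_mul]
  exact hj ⟨ζ, mem_of_mem_nhds hV, rfl⟩

end ProductSpace

end HadamardProducts

/-! ### The main theorem. -/

theorem theoremA {r : ℕ} (hr : 1 ≤ r) (X : Fin r → Type u) [∀ i, MetricSpace (X i)]
    [∀ i, LocallyCompactSpace (X i)] (hX : ∀ i, HadamardProducts.IsHadamard (X i))
    (Γ : Subgroup (∀ i, X i ≃ᵢ X i)) (hΓ : HadamardProducts.ActsProperlyDiscontinuously Γ)
    (hreg : ∃ g ∈ Γ, ∃ h ∈ Γ, HadamardProducts.IsRegularAxial g ∧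
      HadamardProducts.IsRegularAxial h ∧ ∀ i, HadamardProducts.Independent (g i) (h i))
    (x : PiLp 2 X) :
    (∀ γ ∈ Γ, HadamardProducts.actF γ '' HadamardProducts.furstenbergLimitSet Γ x =
      HadamardProducts.furstenbergLimitSet Γ x) ∧
    (∀ ζ : HadamardProducts.FurstenbergBoundary X,
      ∀ U : Set (HadamardProducts.FurstenbergBoundary X), IsOpen U →
        (U ∩ HadamardProducts.furstenbergLimitSet Γ x).Nonempty →
        ∃ γ ∈ Γ, HadamardProducts.actF γ ζ ∈ U) ∧
    (∀ ζ η : HadamardProducts.FurstenbergBoundary X,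
      ∃ ξ ∈ HadamardProducts.furstenbergLimitSet Γ x, ∀ U ∈ 𝓝 ξ,
        ∃ γ ∈ Γ, HadamardProducts.actF γ ζ ∈ U ∧ HadamardProducts.actF γ η ∈ U) ∧
    (∀ ζ : HadamardProducts.FurstenbergBoundary X,
      ∃ V ∈ 𝓝 ζ, ∃ ξ ∈ HadamardProducts.furstenbergLimitSet Γ x, ∀ U ∈ 𝓝 ξ,
        ∃ γ ∈ Γ, HadamardProducts.actF γ '' V ⊆ U) := by
  have hcn : ∀ i, HadamardProducts.IsCNSpace (X i) := fun i => (hX i).isCNSpace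
  have hcomplete : ∀ i, CompleteSpace (X i) := fun i => (hX i).complete
  have hproper : ∀ i, ProperSpace (X i) := fun i =>
    HadamardProducts.properSpace_of_locallyCompact (X i)
  refine ⟨fun γ hγ => HadamardProducts.image_furstenbergLimitSet Γ x hγ,
    fun ζ U hU hne => HadamardProducts.exists_actF_mem hreg ζ hU hne, fun ζ η => ?_, fun ζ => ?_⟩
  -- Only the repelling point has to avoid `ζ` and `η`; the last argument, for the attracting point,
  -- is a filler.
  · obtain ⟨k, hk, σ, l, A, hA⟩ := HadamardProducts.exists_regularAxial_avoiding hreg ζ η ζ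
    obtain ⟨V, hV, hVU⟩ := HadamardProducts.exists_nhds_pow_image_subset A fun i => (hA i).1
    obtain ⟨W, hW, hWU⟩ := HadamardProducts.exists_nhds_pow_image_subset A fun i => (hA i).2.1
    refine ⟨_, HadamardProducts.attr_mem_furstenbergLimitSet hr x hk A, fun U hU => ?_⟩
    obtain ⟨j, h1, h2⟩ := ((hVU U hU).and (hWU U hU)).exists
    exact ⟨k ^ j, Γ.pow_mem hk j, h1 ⟨ζ, mem_of_mem_nhds hV, rfl⟩, h2 ⟨η, mem_of_mem_nhds hW, rfl⟩⟩
  · obtain ⟨k, hk, σ, l, A, hA⟩ := HadamardProducts.exists_regularAxial_avoiding hreg ζ ζ ζ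
    obtain ⟨V, hV, hVU⟩ := HadamardProducts.exists_nhds_pow_image_subset A fun i => (hA i).1
    refine ⟨V, hV, _, HadamardProducts.attr_mem_furstenbergLimitSet hr x hk A, fun U hU => ?_⟩
    obtain ⟨j, hj⟩ := (hVU U hU).exists
    exact ⟨k ^ j, Γ.pow_mem hk j, hj⟩
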